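/- Let $d\ge 2$, let $X$ be a finite set of labels, and let $P=(p_i)_{i\in X}$ and $Q=(q_i)_{i\in X}$ be two point configurations in $\mathbb{R}^d$ (maps $X\to\mathbb{R}^d$) that are full-dimensional, i.e. whose points affinely span $\mathbb{R}^d$. The chirotope of a configuration $R=(r_i)_{i\in Y}$, with $Y$ finite, is the map $\chi_R:Y^{d+1}\to\{-,0,+\}$, $$\chi_R(i_1,\dots,i_{d+1})=\operatorname{sign}\det\begin{pmatrix} r_{i_1}&\cdots&r_{i_{d+1}}\\ 1&\cdots&1\end{pmatrix}.$$ For a finite set $Y\supseteq X$, a configuration $R\in(\mathbb{R}^d)^Y$ extends $P$ if $r_i=p_i$ for all $i\in X$; it is a generic extension of $P$ if moreover no point $r_y$ with $y\in Y\setminus X$ lies on a hyperplane spanned by points of $R$ with labels in $Y\setminus\{y\}$. A map $\chi:Y^{d+1}\to\{-,0,+\}$ is realizable on top of a configuration if it is the chirotope of an extension of it to $Y$. $P$ and $Q$ are directly affinely equivalent if there is an invertible orientation-preserving affine transformation $\varphi$ of $\mathbb{R}^d$ with $\varphi(p_i)=q_i$ for all $i\in X$. Then $P$ and $Q$ are directly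 affinely equivalent if and only if, for every finite $Y\supseteq X$ and every generic extension $R\in(\mathbb{R}^d)^Y$ of $P$, the chirotope of $R$ is realizable on top of $Q$. Moreover, $P$ and $Q$ are directly affinely equivalent if and only if they have the same extensions, that is, for every finite $Y\supseteq X$, a map $Y^{d+1}\to\{-,0,+\}$ is realizable on top of $P$ if and only if it is realizable on top of $Q$. -/

import Mathlib

universe u

/-- A point configuration in `ℝ^d` with labels in `X` is a map from `X` to `ℝ^d`
(the label sets are required to be finite where they are quantified). -/
abbrev PointConfig (d : ℕ) (X : Type u) : Type u := X → (Fin d → ℝ)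

namespace PointConfig

/-- The `(d+1) × (d+1)` matrix whose `j`-th column consists of the coordinates of the `j`-th point
followed by a last entry equal to `1`. -/
def homMatrix {d : ℕ} (p : Fin (d + 1) → (Fin d → ℝ)) :
    Matrix (Fin (d + 1)) (Fin (d + 1)) ℝ :=
  Matrix.of fun i j => (Fin.snoc (p j) (1 : ℝ) : Fin (d + 1) → ℝ) i

/-- The orientation of a `(d+1)`-tuple of points of `ℝ^d`. -/
noncomputable def orient {d : ℕ} (p : Fin (d + 1) → (Fin d → ℝ)) : SignType :=
  SignType.sign (homMatrix p).det

/-- The chirotope of a point configuration: the orientations of all `(d+1)`-tuples of labels. -/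
noncomputable def chirotope {d : ℕ} {X : Type u} (P : PointConfig d X) :
    (Fin (d + 1) → X) → SignType :=
  fun t => orient fun j => P (t j)

/-- The affine hull of the points is the whole space. -/
def FullDimensional {d : ℕ} {X : Type u} (P : PointConfig d X) : Prop :=
  affineSpan ℝ (Set.range P) = ⊤

/-- `P` and `Q` correspond, label by label, under an invertible orientation-preserving affine
transformation of `ℝ^d`. -/
def DirectlyAffinelyEquivalent {d : ℕ} {X : Type u} (P Q : PointConfig d X) : Prop :=
  ∃ φ : (Fin d → ℝ) ≃ᵃ[ℝ] (Fin d → ℝ),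
    0 < LinearMap.det (φ.linear : (Fin d → ℝ) →ₗ[ℝ] (Fin d → ℝ)) ∧ ∀ i, φ (P i) = Q i

/-- `R`, with label set `Y`, extends `P`, with label set `X`; the inclusion of the
label sets is `ι`. -/
def Extends {d : ℕ} {X Y : Type u} (ι : X ↪ Y) (R : PointConfig d Y) (P : PointConfig d X) :
    Prop :=
  ∀ i, R (ι i) = P i

/-- `H` is a hyperplane of `ℝ^d`. -/
def IsHyperplane {d : ℕ} (H : AffineSubspace ℝ (Fin d → ℝ)) : Prop :=
  (H : Set (Fin d → ℝ)).Nonempty ∧ Module.finrank ℝ H.direction + 1 = d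

/-- `R` extends `P`, and no point of `R` with a new label lies on a hyperplane spanned by points
of `R` with other labels. -/
def GenericExtends {d : ℕ} {X Y : Type u} (ι : X ↪ Y) (R : PointConfig d Y)
    (P : PointConfig d X) : Prop :=
  Extends ι R P ∧
    ∀ y : Y, y ∉ Set.range ι → ∀ S : Set Y, y ∉ S →
      IsHyperplane (affineSpan ℝ (R '' S)) → R y ∉ affineSpan ℝ (R '' S)

/-- The chirotope `χ` on `Y` is realizable on top of `P`: some extension of `P` to the
label set `Y` has chirotope `χ`. -/
def RealizableOnTop {d : ℕ} {X Y : Type u} (ι : X ↪ Y) (χ : (Fin (d + 1) → Y) → SignType)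
    (P : PointConfig d X) : Prop :=
  ∃ R : PointConfig d Y, Extends ι R P ∧ chirotope R = χ

/-- Every finite chirotope realizable on top of one of `P`, `Q` is realizable on top
of the other. -/
def SameExtensions {d : ℕ} {X : Type u} (P Q : PointConfig d X) : Prop :=
  ∀ (Y : Type u) [Finite Y] (ι : X ↪ Y) (χ : (Fin (d + 1) → Y) → SignType),
    RealizableOnTop ι χ P ↔ RealizableOnTop ι χ Q

end PointConfig

/-! An orientation-preserving affine map preserves determinant signs, so one direction is transport
of realizations. For the converse, fix a simplex among the points of `P` and write points in
barycentric coordinates with respect to it; points of `Q` are written with respect to the simplex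
with the same labels. Every finite set of points can be approximated by the new points of a generic
extension of `P`, and the realizations of these extensions over `Q` have, by compactness, a limit
(`exists_limit_realization`). It assigns to each vector of positive coordinate sum a nonzero vector
of nonnegative sum, that is, a point at finite or infinite distance. It sends the points of `P` to
those of `Q`, and positive determinants stay nonnegative. This is an `IsWeakMap`, and the theorem
reduces to its rigidity: it multiplies each vector by a positive scalar (`IsWeakMap.eq_smul`).

In rank three the main danger is degeneration, since determinants may vanish in the limit. If an
open set were mapped into a plane, smaller open sets would be mapped to a line and to a ray, and
such a collapse would propagate until it contradicts the fixed simplex (`not_plane`). Consequently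
all strict orientations survive (`tripleProd_pos`). On the open triangle the three pencils of lines
through the vertices are therefore mapped monotonically. In logarithms of coordinate ratios this is
a Cauchy-type functional equation, whose solutions are power maps (`exists_power`). One collinear
triple forces the exponent one (`exists_diagonal`). A diagonal projective map is left, and the line
at infinity makes it scalar.

Two devices finish the rigidity. A map that projectively fixes an open set fixes everything, because
a small simplex face can separate a point from any other candidate image
(`eq_smul_of_eq_smul_on_open`). In higher rank, projection to three coordinates yields a weak map of
rank three wherever the remaining coordinates are negative (`contract`). -/

open Filter Topology

/-! ### Weak maps and the signs of coordinates -/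

/-- A map of homogeneous coordinate vectors, defined where the coordinate sum is positive, that
fixes the coordinate simplex and weakly preserves orientations. -/
structure IsWeakMap {I : Type*} [Fintype I] [DecidableEq I] (F : (I → ℝ) → I → ℝ) : Prop where
  ne_zero : ∀ z, 0 < ∑ i, z i → F z ≠ 0
  sum_nonneg : ∀ z, 0 < ∑ i, z i → 0 ≤ ∑ i, F z i
  fix : ∀ i, F (Pi.single i 1) = Pi.single i 1
  det_nonneg : ∀ z : I → I → ℝ, (∀ i, 0 < ∑ j, z i j) → 0 < (Matrix.of z).det →
    0 ≤ (Matrix.of fun i => F (z i)).det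

namespace IsWeakMap

section General

variable {I : Type*} [Fintype I] [DecidableEq I] {F : (I → ℝ) → I → ℝ}

/-- Swapping two rows reverses both determinants, which is why two distinct indices are needed. -/
theorem det_nonpos [Nontrivial I] (hF : IsWeakMap F) (z : I → I → ℝ) (hz : ∀ i, 0 < ∑ j, z i j)
    (h : (Matrix.of z).det < 0) : (Matrix.of fun i => F (z i)).det ≤ 0 := by
  obtain ⟨a, b, hab⟩ := exists_pair_ne I
  have key : ∀ w : I → I → ℝ,
      (Matrix.of fun i => w (Equiv.swap a b i)).det = -(Matrix.of w).det := by
    intro w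
    have := Matrix.det_permute (Equiv.swap a b) (Matrix.of w)
    rw [Equiv.Perm.sign_swap hab] at this
    simp only [Units.val_neg, Units.val_one, Int.cast_neg, Int.cast_one, neg_one_mul] at this
    exact this
  have h1 := hF.det_nonneg (fun i => z (Equiv.swap a b i)) (fun i => hz _)
    (by rw [key]; linarith)
  have h2 := key fun i => F (z i)
  rw [h2] at h1
  linarith

theorem det_updateRow_one (k : I) (v : I → ℝ) :
    ((1 : Matrix I I ℝ).updateRow k v).det = v k := by
  have h := Matrix.cramer_transpose_apply (1 : Matrix I I ℝ) v k
  rw [Matrix.transpose_one, Matrix.cramer_one] at h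
  simpa using h.symm

theorem of_update_single {I : Type*} [DecidableEq I] (k : I) (v : I → ℝ) :
    (Matrix.of fun i => Function.update (fun j => (Pi.single j 1 : I → ℝ)) k v i) =
      (1 : Matrix I I ℝ).updateRow k v := by
  ext i j
  by_cases h : i = k
  · subst h; simp
  · simp [h, Matrix.one_apply, Pi.single_apply, eq_comm]

theorem map_update (hF : IsWeakMap F) (k : I) (v : I → ℝ) :
    (fun i => F (Function.update (fun j => (Pi.single j 1 : I → ℝ)) k v i)) =
      fun i => Function.update (fun j => (Pi.single j 1 : I → ℝ)) k (F v) i := by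
  funext i
  by_cases h : i = k
  · subst h; simp
  · simp [h, hF.fix]

theorem sum_update_pos (k : I) (v : I → ℝ) (hv : 0 < ∑ j, v j) (i : I) :
    0 < ∑ j, Function.update (fun j => (Pi.single j 1 : I → ℝ)) k v i j := by
  by_cases h : i = k
  · subst h; simpa using hv
  · simp [h]

/-- A coordinate is the determinant of the identity matrix with one row replaced by the vector, and
the other rows are fixed by `F`. -/
theorem coord_nonneg (hF : IsWeakMap F) {z : I → ℝ} (hz : 0 < ∑ i, z i) {k : I} (hk : 0 < z k) :
    0 ≤ F z k := by
  have h := hF.det_nonneg _ (sum_update_pos k z hz)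
    (by rw [show Matrix.of _ = _ from of_update_single k z, det_updateRow_one]; exact hk)
  rw [hF.map_update, of_update_single, det_updateRow_one] at h
  exact h

theorem coord_nonpos [Nontrivial I] (hF : IsWeakMap F) {z : I → ℝ} (hz : 0 < ∑ i, z i) {k : I}
    (hk : z k < 0) : F z k ≤ 0 := by
  have h := hF.det_nonpos _ (sum_update_pos k z hz)
    (by rw [show Matrix.of _ = _ from of_update_single k z, det_updateRow_one]; exact hk)
  rw [hF.map_update, of_update_single, det_updateRow_one] at h
  exact h

end General

end IsWeakMap

/-! ### Algebra of determinants of three vectors -/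

/-- The determinant of three vectors of `ℝ³`. -/
def tripleProd (u v w : Fin 3 → ℝ) : ℝ :=
  u 0 * (v 1 * w 2 - v 2 * w 1) - u 1 * (v 0 * w 2 - v 2 * w 0) + u 2 * (v 0 * w 1 - v 1 * w 0)

namespace tripleProd

theorem eq_det (z : Fin 3 → Fin 3 → ℝ) : (Matrix.of z).det = tripleProd (z 0) (z 1) (z 2) := by
  rw [Matrix.det_fin_three, tripleProd]
  simp only [Matrix.of_apply]
  ring

theorem swap₂₃ (u v w : Fin 3 → ℝ) : tripleProd u w v = -tripleProd u v w := by
  unfold tripleProd; ring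

theorem swap₁₂ (u v w : Fin 3 → ℝ) : tripleProd v u w = -tripleProd u v w := by
  unfold tripleProd; ring

theorem rot (u v w : Fin 3 → ℝ) : tripleProd v w u = tripleProd u v w := by
  unfold tripleProd; ring

theorem smul₁ (c : ℝ) (u v w : Fin 3 → ℝ) : tripleProd (c • u) v w = c * tripleProd u v w := by
  simp [tripleProd]; ring

theorem smul₂ (c : ℝ) (u v w : Fin 3 → ℝ) : tripleProd u (c • v) w = c * tripleProd u v w := by
  simp [tripleProd]; ring

theorem smul₃ (c : ℝ) (u v w : Fin 3 → ℝ) : tripleProd u v (c • w) = c * tripleProd u v w := by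
  simp [tripleProd]; ring

theorem add₁ (u u' v w : Fin 3 → ℝ) :
    tripleProd (u + u') v w = tripleProd u v w + tripleProd u' v w := by
  simp [tripleProd]; ring

theorem add₂ (u v v' w : Fin 3 → ℝ) :
    tripleProd u (v + v') w = tripleProd u v w + tripleProd u v' w := by
  simp [tripleProd]; ring

theorem add₃ (u v w w' : Fin 3 → ℝ) :
    tripleProd u v (w + w') = tripleProd u v w + tripleProd u v w' := by
  simp [tripleProd]; ring

@[simp] theorem self₁₂ (u v : Fin 3 → ℝ) : tripleProd u u v = 0 := by unfold tripleProd; ring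

@[simp] theorem self₁₃ (u v : Fin 3 → ℝ) : tripleProd u v u = 0 := by unfold tripleProd; ring

@[simp] theorem self₂₃ (u v : Fin 3 → ℝ) : tripleProd u v v = 0 := by unfold tripleProd; ring

theorem cramer (a b c v : Fin 3 → ℝ) :
    tripleProd a b c • v =
      tripleProd v b c • a + tripleProd a v c • b + tripleProd a b v • c := by
  ext i
  fin_cases i <;> simp [tripleProd] <;> ring

theorem continuous {α : Type*} [TopologicalSpace α] {f g h : α → Fin 3 → ℝ} (hf : Continuous f)
    (hg : Continuous g) (hh : Continuous h) : Continuous fun x => tripleProd (f x) (g x) (h x) := by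
  unfold tripleProd
  fun_prop

theorem exists_ne_zero {u v : Fin 3 → ℝ} (hu : u ≠ 0) (hv : ¬∃ c : ℝ, v = c • u) :
    ∃ w, tripleProd u v w ≠ 0 := by
  by_contra! h
  have h0 := h (Pi.single 0 1)
  have h1 := h (Pi.single 1 1)
  have h2 := h (Pi.single 2 1)
  simp [tripleProd] at h0 h1 h2
  apply hv
  obtain ⟨i, hi⟩ := Function.ne_iff.mp hu
  refine ⟨v i / u i, ?_⟩
  have hi' : u i ≠ 0 := hi
  ext j
  simp only [Pi.smul_apply, smul_eq_mul]
  rw [div_mul_eq_mul_div, eq_div_iff hi']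
  fin_cases i <;> fin_cases j <;> simp <;> linarith

/-- Modulo `y` the vectors live in a plane, where being parallel is transitive through a nonzero
vector. Cramer's rule makes this explicit: if `y`, `a`, `b` were independent, `v` would be a
multiple of `y`. -/
theorem trans {y a b v : Fin 3 → ℝ} (hv : ¬∃ c : ℝ, v = c • y)
    (ha : tripleProd y a v = 0) (hb : tripleProd y v b = 0) : tripleProd y a b = 0 := by
  by_contra h
  have := cramer y a b v
  rw [hb, ha, zero_smul, zero_smul, add_zero, add_zero] at this
  exact hv ⟨(tripleProd y a b)⁻¹ * tripleProd v a b, by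
    rw [mul_smul, ← this, smul_smul, inv_mul_cancel₀ h, one_smul]⟩

end tripleProd

/-! ### Rank three: open sets do not collapse -/

/-- The coordinate sum of a vector of `ℝ³` is positive. -/
abbrev SumPos (z : Fin 3 → ℝ) : Prop := 0 < ∑ i, z i

theorem isOpen_sumPos : IsOpen {z : Fin 3 → ℝ | SumPos z} :=
  isOpen_lt continuous_const (by fun_prop)

theorem eventually_add_smul_mem {A : Set (Fin 3 → ℝ)} (hA : IsOpen A) {a : Fin 3 → ℝ} (ha : a ∈ A)
    (w : Fin 3 → ℝ) : ∀ᶠ t : ℝ in 𝓝[>] 0, a + t • w ∈ A := by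
  have hc : Continuous fun t : ℝ => a + t • w := by fun_prop
  have : ∀ᶠ t : ℝ in 𝓝 0, a + t • w ∈ A :=
    hc.continuousAt.eventually_mem (hA.mem_nhds (by simpa using ha))
  exact this.filter_mono nhdsWithin_le_nhds

theorem exists_tripleProd_pos {A : Set (Fin 3 → ℝ)} (hA : IsOpen A) {a p q w : Fin 3 → ℝ}
    (ha : a ∈ A) (h : tripleProd a p q = 0) (hw : tripleProd w p q ≠ 0) :
    ∃ u ∈ A, 0 < tripleProd u p q := by
  obtain ⟨t, ht, ht0⟩ := ((eventually_add_smul_mem hA ha (tripleProd w p q • w)).and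
    self_mem_nhdsWithin).exists
  refine ⟨_, ht, ?_⟩
  rw [tripleProd.add₁, tripleProd.smul₁, tripleProd.smul₁, h, zero_add]
  exact mul_pos ht0 (mul_self_pos.mpr hw)

namespace IsWeakMap

variable {F : (Fin 3 → ℝ) → Fin 3 → ℝ}

theorem tripleProd_nonneg (hF : IsWeakMap F) {a b c : Fin 3 → ℝ} (ha : SumPos a) (hb : SumPos b)
    (hc : SumPos c) (h : 0 < tripleProd a b c) : 0 ≤ tripleProd (F a) (F b) (F c) := by
  have := hF.det_nonneg ![a, b, c] (by intro i; fin_cases i <;> assumption)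
    (by rw [tripleProd.eq_det]; exact h)
  rw [tripleProd.eq_det] at this
  exact this

theorem tripleProd_nonpos (hF : IsWeakMap F) {a b c : Fin 3 → ℝ} (ha : SumPos a) (hb : SumPos b)
    (hc : SumPos c) (h : tripleProd a b c < 0) : tripleProd (F a) (F b) (F c) ≤ 0 := by
  have := hF.tripleProd_nonneg ha hc hb (by rw [tripleProd.swap₂₃]; linarith)
  rw [tripleProd.swap₂₃] at this
  linarith

/-- If an open set is mapped to a ray, then a line through it is mapped to a line through
that ray. -/
theorem line_of_ray (hF : IsWeakMap F) {A : Set (Fin 3 → ℝ)} (hA : IsOpen A)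
    (hAD : ∀ u ∈ A, SumPos u) {y : Fin 3 → ℝ} (hAy : ∀ u ∈ A, ∃ c : ℝ, 0 < c ∧ F u = c • y)
    {a x x' w : Fin 3 → ℝ} (ha : a ∈ A) (hx : SumPos x) (hx' : SumPos x')
    (h : tripleProd a x x' = 0) (hw : tripleProd w x x' ≠ 0) :
    tripleProd y (F x) (F x') = 0 := by
  -- Near `a`, the set `A` has points on both sides of the plane of `x` and `x'`, all mapped to the
  -- ray of `y`. One side gives one inequality; exchanging `x` and `x'` gives the other.
  have key : ∀ x x', SumPos x → SumPos x' → tripleProd a x x' = 0 → tripleProd w x x' ≠ 0 →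
      0 ≤ tripleProd y (F x) (F x') := by
    intro x x' hx hx' h hw
    obtain ⟨u, hu, hpos⟩ := exists_tripleProd_pos hA ha h hw
    obtain ⟨c, hc, hcu⟩ := hAy u hu
    have := hF.tripleProd_nonneg (hAD u hu) hx hx' hpos
    rw [hcu, tripleProd.smul₁] at this
    exact nonneg_of_mul_nonneg_right this hc
  have h1 := key x x' hx hx' h hw
  have h2 := key x' x hx' hx (by rw [tripleProd.swap₂₃, h, neg_zero])
    (by rw [tripleProd.swap₂₃]; simpa using hw)
  rw [tripleProd.swap₂₃] at h2
  linarith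

theorem exists_not_parallel {A : Set (Fin 3 → ℝ)} (hA : IsOpen A) (hne : A.Nonempty)
    {x : Fin 3 → ℝ} (hx : x ≠ 0) : ∃ a ∈ A, ∃ w, tripleProd w a x ≠ 0 := by
  obtain ⟨a, ha⟩ := hne
  obtain ⟨p, hp⟩ : ∃ p : Fin 3 → ℝ, ¬∃ c : ℝ, p = c • x := by
    by_contra! h
    obtain ⟨c, hc⟩ := h (Pi.single 0 1)
    obtain ⟨c', hc'⟩ := h (Pi.single 1 1)
    have h1 := congrFun hc 0
    have h2 := congrFun hc 1
    have h3 := congrFun hc' 0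
    have h4 := congrFun hc' 1
    simp at h1 h2 h3 h4
    rcases h2 with h2 | h2
    · simp [h2] at h1
    · simp [h2] at h4
  obtain ⟨w, hw⟩ := tripleProd.exists_ne_zero hx hp
  by_cases h : tripleProd w a x = 0
  · obtain ⟨t, ht, ht0⟩ := ((eventually_add_smul_mem hA ha p).and self_mem_nhdsWithin).exists
    refine ⟨_, ht, w, ?_⟩
    rw [tripleProd.add₂, tripleProd.smul₂, h, zero_add]
    have : tripleProd w p x = -tripleProd x p w := by unfold tripleProd; ring
    rw [this]
    have ht0' : (0:ℝ) < t := ht0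
    exact mul_ne_zero ht0'.ne' (neg_ne_zero.mpr hw)
  · exact ⟨a, ha, w, h⟩

/-- If an open set is mapped to a ray spanned by `y`, then a connected open set whose image avoids
the line spanned by `y` is mapped to a plane through `y`. -/
theorem plane_of_ray (hF : IsWeakMap F) {A : Set (Fin 3 → ℝ)} (hA : IsOpen A) (hne : A.Nonempty)
    (hAD : ∀ u ∈ A, SumPos u) {y : Fin 3 → ℝ}
    (hAy : ∀ u ∈ A, ∃ c : ℝ, 0 < c ∧ F u = c • y)
    {S : Set (Fin 3 → ℝ)} (hS : IsOpen S) (hSc : IsPreconnected S) (hSD : ∀ x ∈ S, SumPos x)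
    (hSy : ∀ x ∈ S, ¬∃ c : ℝ, F x = c • y) {x x' : Fin 3 → ℝ} (hx : x ∈ S) (hx' : x' ∈ S) :
    tripleProd y (F x) (F x') = 0 := by
  refine hSc.induction₂' (fun x x' => tripleProd y (F x) (F x') = 0) ?_ ?_ hx hx'
  · intro x hx
    have hx0 : x ≠ 0 := by
      rintro rfl
      simpa [SumPos] using hSD _ hx
    obtain ⟨a, ha, w, hw⟩ := exists_not_parallel hA hne hx0
    -- The vector `x - τ a` is a common anchor: for `x'` near `x` it equals `x' - τ a'` with `a' = a
    -- + τ⁻¹ (x' - x)` still in `A`. Hence `line_of_ray` puts `F x` and `F x'` in the plane spanned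
    -- by `y` and the image of the anchor, which lies off the line of `y`. This is the local
    -- statement; connectedness of `S` and `tripleProd.trans` globalize it.
    obtain ⟨τ, hτS, hτ0⟩ := ((eventually_add_smul_mem hS hx (-a)).and self_mem_nhdsWithin).exists
    have hτ : (0:ℝ) < τ := hτ0
    have hc : Continuous fun x' : Fin 3 → ℝ => a + τ⁻¹ • (x' - x) := by fun_prop
    have h1 : ∀ᶠ x' in 𝓝 x, a + τ⁻¹ • (x' - x) ∈ A :=
      hc.continuousAt.eventually_mem (hA.mem_nhds (by simpa using ha))
    have h2 : ∀ᶠ x' in 𝓝 x, tripleProd w (a + τ⁻¹ • (x' - x)) x' ≠ 0 :=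
      (tripleProd.continuous continuous_const hc continuous_id).continuousAt.eventually_ne
        (by simpa using hw)
    have hlink : ∀ x', x' ∈ S → a + τ⁻¹ • (x' - x) ∈ A →
        tripleProd w (a + τ⁻¹ • (x' - x)) x' ≠ 0 →
        tripleProd y (F x') (F (x + τ • -a)) = 0 := by
      intro x' hx'S hx'A hx'w
      have hv : x + τ • -a = x' + (-τ) • (a + τ⁻¹ • (x' - x)) := by
        ext i
        simp
        field_simp
        ring
      refine hF.line_of_ray hA hAD hAy (w := w) hx'A (hSD _ hx'S) (hSD _ hτS) ?_ ?_
      · rw [hv, tripleProd.add₃, tripleProd.smul₃]; simp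
      · rw [hv, tripleProd.add₃, tripleProd.smul₃, tripleProd.self₂₃, tripleProd.swap₂₃, zero_add]
        exact mul_ne_zero (neg_ne_zero.mpr hτ.ne') (neg_ne_zero.mpr hx'w)
    have hxx := hlink x hx (by simpa using ha) (by simpa using hw)
    filter_upwards [nhdsWithin_le_nhds h1, nhdsWithin_le_nhds h2, self_mem_nhdsWithin]
      with x' h1 h2 hx'S
    have hxx' := hlink x' hx'S h1 h2
    have : tripleProd y (F x) (F x') = 0 :=
      tripleProd.trans (hSy _ hτS) hxx (by rw [tripleProd.swap₂₃, hxx', neg_zero])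
    exact ⟨this, by rw [tripleProd.swap₂₃, this, neg_zero]⟩
  · intro a b c _ hb _ hab hbc
    exact tripleProd.trans (hSy _ hb) hab hbc

end IsWeakMap

theorem tripleProd.exists_eq_smul {u v : Fin 3 → ℝ} (hu : u ≠ 0) (h : ∀ w, tripleProd w u v = 0) :
    ∃ c : ℝ, v = c • u := by
  by_contra hv
  obtain ⟨w, hw⟩ := tripleProd.exists_ne_zero hu hv
  exact hw (by rw [← tripleProd.rot, ← tripleProd.rot]; exact h w)

theorem convex_tripleProd_neg (p q : Fin 3 → ℝ) :
    Convex ℝ {w : Fin 3 → ℝ | SumPos w ∧ tripleProd w p q < 0} := by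
  intro x hx x' hx' a b ha hb hab
  have hs : ∑ i, (a • x + b • x') i = a * ∑ i, x i + b * ∑ i, x' i := by
    simp [Fin.sum_univ_three]; ring
  have ht : tripleProd (a • x + b • x') p q = a * tripleProd x p q + b * tripleProd x' p q := by
    rw [tripleProd.add₁, tripleProd.smul₁, tripleProd.smul₁]
  have h1 : 0 < ∑ i, x i := hx.1
  have h2 : 0 < ∑ i, x' i := hx'.1
  have h3 := hx.2
  have h4 := hx'.2
  constructor
  · change 0 < _
    rw [hs]
    rcases ha.eq_or_lt with rfl | ha
    · have : b = 1 := by linarith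
      simp [this, h2]
    · positivity
  · rw [ht]
    rcases ha.eq_or_lt with rfl | ha
    · have : b = 1 := by linarith
      simp [this, h4]
    · nlinarith

namespace IsWeakMap

variable {F : (Fin 3 → ℝ) → Fin 3 → ℝ}

/-- A point mapped to the line of `y` is mapped to its positive ray, since `y` has positive sum, and
so cannot lie strictly on the negative side of the plane of `p` and `q`. By `plane_of_ray` that
whole side goes to one plane through `y`. For `a` in `A` on the positive side, `p - τ a` and `q - τ
a` lie on the negative side, and `line_of_ray` ties their images to `F p` and `F q`. Thus `y`, `F
p`, `F q` would be coplanar. -/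
theorem not_ray_of_tripleProd_pos (hF : IsWeakMap F) {A : Set (Fin 3 → ℝ)} (hA : IsOpen A)
    (hne : A.Nonempty) (hAD : ∀ u ∈ A, SumPos u) {y : Fin 3 → ℝ} (hy : SumPos y)
    (hAy : ∀ u ∈ A, ∃ c : ℝ, 0 < c ∧ F u = c • y) {p q : Fin 3 → ℝ} (hp : SumPos p)
    (hq : SumPos q) (hpq : 0 < tripleProd y (F p) (F q)) {w : Fin 3 → ℝ}
    (hw : tripleProd w p q ≠ 0) : False := by
  have hpos : ∀ z, SumPos z → ∀ c : ℝ, F z = c • y → 0 < c := by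
    intro z hz c hc
    have h1 := hF.sum_nonneg z hz
    have h2 := hF.ne_zero z hz
    rw [hc] at h1 h2
    have h3 : ∑ i, (c • y) i = c * ∑ i, y i := by simp [Finset.mul_sum]
    rw [h3] at h1
    have h4 : 0 ≤ c := nonneg_of_mul_nonneg_left h1 hy
    exact h4.lt_of_ne (by rintro rfl; simp at h2)
  have hside : ∀ z, SumPos z → (∃ c : ℝ, F z = c • y) → 0 ≤ tripleProd z p q := by
    rintro z hz ⟨c, hc⟩
    by_contra! h
    have := hF.tripleProd_nonpos hz hp hq h
    rw [hc, tripleProd.smul₁] at this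
    have := mul_pos (hpos z hz c hc) hpq
    linarith
  obtain ⟨a, ha, haw⟩ : ∃ a ∈ A, 0 < tripleProd a p q := by
    obtain ⟨a, ha⟩ := hne
    obtain ⟨c, _, hc⟩ := hAy a ha
    rcases (hside a (hAD a ha) ⟨c, hc⟩).eq_or_lt with h | h
    · exact exists_tripleProd_pos hA ha h.symm hw
    · exact ⟨a, ha, h⟩
  set S := {w : Fin 3 → ℝ | SumPos w ∧ tripleProd w p q < 0} with hSdef
  have hS : IsOpen S := isOpen_sumPos.inter
    (isOpen_lt (tripleProd.continuous continuous_id continuous_const continuous_const)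
      continuous_const)
  have hSy : ∀ x ∈ S, ¬∃ c : ℝ, F x = c • y := by
    intro x hx h
    exact absurd (hside x hx.1 h) (not_le.mpr hx.2)
  obtain ⟨τ, ⟨hτp, hτq⟩, hτ0⟩ :=
    (((eventually_add_smul_mem isOpen_sumPos (a := p) hp (-a)).and
      (eventually_add_smul_mem isOpen_sumPos (a := q) hq (-a))).and self_mem_nhdsWithin).exists
  have hτ : (0:ℝ) < τ := hτ0
  have hτa := mul_pos hτ haw
  have hneg : ∀ x, x = p ∨ x = q → tripleProd (x + τ • -a) p q < 0 := by
    intro x hx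
    have : tripleProd (x + τ • -a) p q = - (τ * tripleProd a p q) := by
      rcases hx with rfl | rfl <;> simp [tripleProd] <;> ring
    rw [this]; linarith
  have hlink : ∀ x w, SumPos x → SumPos (x + τ • -a) → tripleProd w a x ≠ 0 →
      tripleProd y (F x) (F (x + τ • -a)) = 0 := by
    intro x w hx hx' hw
    have e : ∀ w, tripleProd w x (x + τ • -a) = τ * tripleProd w a x := by
      intro w; simp [tripleProd]; ring
    exact hF.line_of_ray hA hAD hAy ha hx hx' (by rw [e]; simp)
      (w := w) (by rw [e]; exact mul_ne_zero hτ.ne' hw)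
  have h1 := hlink p q hp hτp (by rw [← tripleProd.rot]; exact haw.ne')
  have h2 := hlink q p hq hτq (by rw [tripleProd.swap₁₂]; simpa using haw.ne')
  have h3 := hF.plane_of_ray hA ⟨a, ha⟩ hAD hAy hS (convex_tripleProd_neg p q).isPreconnected
    (fun x hx => hx.1) hSy (x := p + τ • -a) (x' := q + τ • -a) ⟨hτp, hneg p (Or.inl rfl)⟩
    ⟨hτq, hneg q (Or.inr rfl)⟩
  have h4 := tripleProd.trans (hSy _ ⟨hτp, hneg p (Or.inl rfl)⟩) h1 h3
  have h5 := tripleProd.trans (hSy _ ⟨hτq, hneg q (Or.inr rfl)⟩) h4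
    (by rw [tripleProd.swap₂₃, h2, neg_zero])
  exact hpq.ne' h5

/-- No nonempty open set is mapped to a ray off the plane at infinity. -/
theorem not_finite_ray (hF : IsWeakMap F) {A : Set (Fin 3 → ℝ)} (hA : IsOpen A)
    (hne : A.Nonempty) (hAD : ∀ u ∈ A, SumPos u) {y : Fin 3 → ℝ} (hy : SumPos y)
    (hAy : ∀ u ∈ A, ∃ c : ℝ, 0 < c ∧ F u = c • y) : False := by
  have hs : ∀ i : Fin 3, SumPos (Pi.single i 1) := fun i => by simp [SumPos]
  have key : ∀ i j : Fin 3, tripleProd y (Pi.single i 1) (Pi.single j 1) ≠ 0 → False := by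
    intro i j h
    rcases h.lt_or_gt with h' | h'
    · refine hF.not_ray_of_tripleProd_pos hA hne hAD hy hAy (hs j) (hs i) (w := y) ?_ ?_
      · rw [hF.fix, hF.fix, tripleProd.swap₂₃]; linarith
      · rw [tripleProd.swap₂₃]; simpa using h
    · refine hF.not_ray_of_tripleProd_pos hA hne hAD hy hAy (hs i) (hs j) (w := y) ?_ h
      rw [hF.fix, hF.fix]; exact h'
  have h0 : y 0 = 0 := by
    by_contra h
    exact key 1 2 (by simpa [tripleProd] using h)
  have h1 : y 1 = 0 := by
    by_contra h
    exact key 0 2 (by simpa [tripleProd] using h)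
  have h2 : y 2 = 0 := by
    by_contra h
    exact key 0 1 (by simpa [tripleProd] using h)
  simp [SumPos, Fin.sum_univ_three, h0, h1, h2] at hy

/-- Some two independent points are mapped off any given plane. -/
theorem exists_pair_off_plane (hF : IsWeakMap F) {k : Fin 3 → ℝ} (hk : k ≠ 0) :
    ∃ z z' w, SumPos z ∧ SumPos z' ∧ k ⬝ᵥ F z ≠ 0 ∧ k ⬝ᵥ F z' ≠ 0 ∧ tripleProd w z z' ≠ 0 := by
  have hs : ∀ i : Fin 3, SumPos (Pi.single i 1) := fun i => by simp [SumPos]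
  have hd : ∀ i : Fin 3, k ⬝ᵥ F (Pi.single i 1) = k i := fun i => by rw [hF.fix]; simp
  by_cases h01 : k 0 ≠ 0 ∧ k 1 ≠ 0
  · exact ⟨_, _, Pi.single 2 1, hs 0, hs 1, by rw [hd]; exact h01.1, by rw [hd]; exact h01.2,
      by simp [tripleProd]⟩
  by_cases h02 : k 0 ≠ 0 ∧ k 2 ≠ 0
  · exact ⟨_, _, Pi.single 1 1, hs 0, hs 2, by rw [hd]; exact h02.1, by rw [hd]; exact h02.2,
      by simp [tripleProd]⟩
  by_cases h12 : k 1 ≠ 0 ∧ k 2 ≠ 0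
  · exact ⟨_, _, Pi.single 0 1, hs 1, hs 2, by rw [hd]; exact h12.1, by rw [hd]; exact h12.2,
      by simp [tripleProd]⟩
  -- If only `k i` is nonzero, a single vertex is off the plane. A second point is one whose other
  -- coordinates are negative: its image has nonpositive entries there and nonnegative sum, so a
  -- vanishing entry at `i` would make it zero.
  have hU : ∀ z : Fin 3 → ℝ, SumPos z → ∀ i, (∀ j, j ≠ i → z j < 0) → F z i ≠ 0 := by
    intro z hz i hneg h
    have h1 : ∀ j, F z j ≤ 0 := by
      intro j
      by_cases hj : j = i
      · rw [hj, h]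
      · exact hF.coord_nonpos hz (hneg j hj)
    have h2 := hF.sum_nonneg z hz
    have h3 := (Finset.sum_eq_zero_iff_of_nonpos fun j _ => h1 j).mp
      (le_antisymm (Finset.sum_nonpos fun j _ => h1 j) h2)
    exact hF.ne_zero z hz (funext fun j => h3 j (Finset.mem_univ j))
  obtain ⟨i, hi⟩ := Function.ne_iff.mp hk
  have hi' : k i ≠ 0 := hi
  have hother : ∀ j, j ≠ i → k j = 0 := by
    intro j hj
    by_contra hkj
    fin_cases i <;> fin_cases j <;> simp_all
  have hd' : ∀ v : Fin 3 → ℝ, k ⬝ᵥ v = k i * v i := by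
    intro v
    rw [dotProduct, Finset.sum_eq_single i]
    · intro j _ hj; rw [hother j hj, zero_mul]
    · simp
  have hz : SumPos (fun j => if j = i then (3:ℝ) else -1) := by
    fin_cases i <;> simp [SumPos, Fin.sum_univ_three] <;> norm_num
  refine ⟨Pi.single i 1, fun j => if j = i then (3:ℝ) else -1, Pi.single (i + 1) 1, hs i, hz,
    by rw [hd]; exact hi', ?_, ?_⟩
  · rw [hd']
    exact mul_ne_zero hi' (hU _ hz i fun j hj => by simp [hj])
  · fin_cases i <;> simp [tripleProd]

/-- If an open set is mapped to a plane, then a smaller open set is mapped to a line. -/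
theorem exists_open_line (hF : IsWeakMap F) {A : Set (Fin 3 → ℝ)} (hA : IsOpen A)
    (hne : A.Nonempty) (hAD : ∀ u ∈ A, SumPos u) {k : Fin 3 → ℝ} (hk : k ≠ 0)
    (hAk : ∀ u ∈ A, k ⬝ᵥ F u = 0) :
    ∃ u ∈ A, ∃ A' ⊆ A, IsOpen A' ∧ A'.Nonempty ∧ ∀ v ∈ A', ∃ c : ℝ, F v = c • F u := by
  obtain ⟨z, z', w, hz, hz', hkz, hkz', hw⟩ := hF.exists_pair_off_plane hk
  obtain ⟨u, hu, huz⟩ : ∃ u ∈ A, tripleProd u z z' ≠ 0 := by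
    obtain ⟨a, ha⟩ := hne
    by_cases h : tripleProd a z z' = 0
    · obtain ⟨u, hu, h⟩ := exists_tripleProd_pos hA ha h hw
      exact ⟨u, hu, h.ne'⟩
    · exact ⟨a, ha, h⟩
  -- For images in the plane `k`, the determinants of `F u`, `F v` with `F z` and with `F z'` are
  -- proportional to the heights of `F z` and `F z'` over that plane, so `m` has the sign relating
  -- them. The open set below prescribes signs of `[z u v]` and `[z' u v]` that contradict this
  -- relation unless `F u` and `F v` are parallel.
  set m := (k ⬝ᵥ F z) * (k ⬝ᵥ F z') with hm
  have hm0 : m ≠ 0 := mul_ne_zero hkz hkz'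
  refine ⟨u, hu, A ∩ {v | 0 < tripleProd z u v ∧ 0 < -m * tripleProd z' u v},
    Set.inter_subset_left, hA.inter ((isOpen_lt continuous_const (tripleProd.continuous
      continuous_const continuous_const continuous_id)).inter (isOpen_lt continuous_const
      (continuous_const.mul (tripleProd.continuous continuous_const continuous_const
      continuous_id)))), ?_, ?_⟩
  -- The direction is a combination of `z` and `z'` whose coefficients turn both required
  -- determinants into `t` times a nonzero square.
  · obtain ⟨t, ht, ht0⟩ := ((eventually_add_smul_mem hA hu
      ((-m * tripleProd z' u z) • z + tripleProd z u z' • z')).and self_mem_nhdsWithin).exists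
    have ht' : (0:ℝ) < t := ht0
    have e1 : tripleProd z u z' = tripleProd u z' z := by unfold tripleProd; ring
    have e2 : tripleProd z' u z = -tripleProd u z' z := by unfold tripleProd; ring
    have e3 : tripleProd u z' z ≠ 0 := by rw [tripleProd.swap₂₃]; simpa using huz
    refine ⟨_, ht, ?_, ?_⟩
    · have : tripleProd z u (u + t • ((-m * tripleProd z' u z) • z + tripleProd z u z' • z')) =
          t * (tripleProd u z' z * tripleProd u z' z) := by
        rw [tripleProd.add₃, tripleProd.smul₃, tripleProd.add₃, tripleProd.smul₃,
          tripleProd.smul₃, e1]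
        simp
      rw [this]
      exact mul_pos ht' (mul_self_pos.mpr e3)
    · have : -m * tripleProd z' u
          (u + t • ((-m * tripleProd z' u z) • z + tripleProd z u z' • z')) =
          t * ((m * tripleProd u z' z) * (m * tripleProd u z' z)) := by
        rw [tripleProd.add₃, tripleProd.smul₃, tripleProd.add₃, tripleProd.smul₃,
          tripleProd.smul₃, e2]
        simp
        ring
      rw [this]
      exact mul_pos ht' (mul_self_pos.mpr (mul_ne_zero hm0 e3))
  · rintro v ⟨hv, hv1, hv2⟩
    have hsu := hAD u hu
    have hsv := hAD v hv
    have key : ∀ w w', (k ⬝ᵥ w') * tripleProd w (F u) (F v) =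
        (k ⬝ᵥ w) * tripleProd w' (F u) (F v) := by
      intro w w'
      have := congrArg (fun x => k ⬝ᵥ x) (tripleProd.cramer w (F u) (F v) w')
      simp only [dotProduct_add, dotProduct_smul, hAk u hu, hAk v hv, smul_eq_mul, mul_zero,
        add_zero] at this
      linarith
    have h1 := hF.tripleProd_nonneg hz hsu hsv hv1
    have h2 : m * tripleProd (F z') (F u) (F v) ≤ 0 := by
      rcases lt_trichotomy m 0 with h | h | h
      · have := hF.tripleProd_nonneg hz' hsu hsv (by nlinarith)
        nlinarith
      · exact absurd h hm0
      · have := hF.tripleProd_nonpos hz' hsu hsv (by nlinarith)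
        nlinarith
    have h3 := key (F z) (F z')
    have h4 : tripleProd (F z) (F u) (F v) = 0 := by
      have h5 : m * tripleProd (F z') (F u) (F v) =
          (k ⬝ᵥ F z') ^ 2 * tripleProd (F z) (F u) (F v) := by
        rw [hm]; linear_combination (-(k ⬝ᵥ F z')) * h3
      rw [h5] at h2
      have h6 : 0 < (k ⬝ᵥ F z') ^ 2 := by positivity
      nlinarith
    refine tripleProd.exists_eq_smul (hF.ne_zero u hsu) fun w => ?_
    have := key w (F z)
    rw [h4, mul_zero] at this
    rw [dotProduct_comm] at hkz
    rcases mul_eq_zero.mp this with h | h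
    · rw [dotProduct_comm] at h; exact absurd h hkz
    · exact h

end IsWeakMap

theorem tripleProd.exists_normal (u v : Fin 3 → ℝ) :
    ∃ k : Fin 3 → ℝ, ∀ w, tripleProd u v w = k ⬝ᵥ w := by
  refine ⟨![u 1 * v 2 - u 2 * v 1, u 2 * v 0 - u 0 * v 2, u 0 * v 1 - u 1 * v 0], fun w => ?_⟩
  simp [tripleProd, dotProduct, Fin.sum_univ_three]
  ring

theorem tripleProd.exists_pair_ne_zero {u : Fin 3 → ℝ} (hu : u ≠ 0) :
    ∃ v w, tripleProd u v w ≠ 0 := by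
  obtain ⟨i, hi⟩ := Function.ne_iff.mp hu
  have hi' : u i ≠ 0 := hi
  refine ⟨Pi.single (i + 1) 1, Pi.single (i + 2) 1, ?_⟩
  fin_cases i <;> simpa [tripleProd] using hi'

theorem sum_combo (x y z : ℝ) (a b c : Fin 3 → ℝ) :
    ∑ i, (x • a + y • b + z • c) i = x * ∑ i, a i + y * ∑ i, b i + z * ∑ i, c i := by
  simp [Fin.sum_univ_three]; ring

namespace IsWeakMap

variable {F : (Fin 3 → ℝ) → Fin 3 → ℝ}

/-- If an open set is mapped to a line, then a smaller open set is mapped to a ray. -/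
theorem exists_open_ray (hF : IsWeakMap F) {A : Set (Fin 3 → ℝ)} (hA : IsOpen A)
    (hne : A.Nonempty) (hAD : ∀ u ∈ A, SumPos u) {y : Fin 3 → ℝ}
    (hAy : ∀ u ∈ A, ∃ c : ℝ, F u = c • y) :
    ∃ u ∈ A, ∃ A' ⊆ A, IsOpen A' ∧ A'.Nonempty ∧ ∀ v ∈ A', ∃ c : ℝ, 0 < c ∧ F v = c • F u := by
  obtain ⟨a, ha, ha0⟩ : ∃ a ∈ A, ∀ i, a i ≠ 0 := by
    obtain ⟨a, ha⟩ := hne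
    have h : ∀ i : Fin 3, ∀ᶠ t : ℝ in 𝓝[>] 0, a i + t ≠ 0 := by
      intro i
      by_cases hi : a i = 0
      · filter_upwards [self_mem_nhdsWithin] with t ht
        rw [hi, zero_add]
        exact (show (0:ℝ) < t from ht).ne'
      · have : Continuous fun t : ℝ => a i + t := by fun_prop
        exact (this.continuousAt.eventually_ne (by simpa using hi)).filter_mono nhdsWithin_le_nhds
    obtain ⟨t, ht, ht'⟩ :=
      ((eventually_add_smul_mem hA ha (fun _ => 1)).and (eventually_all.mpr h)).exists
    exact ⟨_, ht, fun i => by simpa using ht' i⟩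
  -- For `v` with the sign pattern of `a`, the positive part of the pattern carries a strictly
  -- positive share of `F v`: otherwise all entries would be nonpositive with nonnegative sum. This
  -- linear functional has constant sign on the images, so they lie on one side of the origin of the
  -- line.
  have hg : ∀ v, SumPos v → (∀ i, 0 < v i * a i) → 0 < ∑ i, if 0 < a i then F v i else 0 := by
    intro v hv hva
    have hp : ∀ i, 0 < a i → 0 ≤ F v i := fun i hi =>
      hF.coord_nonneg hv ((pos_iff_pos_of_mul_pos (hva i)).mpr hi)
    have hn : ∀ i, ¬0 < a i → F v i ≤ 0 := by
      intro i hi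
      have hi' : a i < 0 := lt_of_le_of_ne (not_lt.mp hi) (ha0 i)
      refine hF.coord_nonpos hv ?_
      have := hva i
      nlinarith
    have h0 : ∀ i, 0 ≤ if 0 < a i then F v i else 0 := by
      intro i; split_ifs with h
      exacts [hp i h, le_rfl]
    have h1 : ∀ i, F v i ≤ if 0 < a i then F v i else 0 := by
      intro i; split_ifs with h
      exacts [le_rfl, hn i h]
    refine (Finset.sum_nonneg fun i _ => h0 i).lt_of_ne fun h => ?_
    have h2 := (Finset.sum_eq_zero_iff_of_nonneg fun i _ => h0 i).mp h.symm
    have h3 : ∀ i, F v i ≤ 0 := fun i => (h1 i).trans (h2 i (Finset.mem_univ i)).le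
    have h4 := (Finset.sum_eq_zero_iff_of_nonpos fun j _ => h3 j).mp
      (le_antisymm (Finset.sum_nonpos fun j _ => h3 j) (hF.sum_nonneg v hv))
    exact hF.ne_zero v hv (funext fun j => h4 j (Finset.mem_univ j))
  refine ⟨a, ha, A ∩ {v | ∀ i, 0 < v i * a i}, Set.inter_subset_left, hA.inter ?_,
    ⟨a, ha, fun i => mul_self_pos.mpr (ha0 i)⟩, ?_⟩
  · rw [Set.ofPred_forall]
    exact isOpen_iInter_of_finite fun i => isOpen_lt continuous_const (by fun_prop)
  · rintro v ⟨hv, hva⟩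
    obtain ⟨c, hc⟩ := hAy v hv
    obtain ⟨d, hd⟩ := hAy a ha
    have hgc : ∀ e : ℝ, (∑ i, if 0 < a i then (e • y) i else 0) =
        e * ∑ i, if 0 < a i then y i else 0 := by
      intro e
      rw [Finset.mul_sum]
      refine Finset.sum_congr rfl fun i _ => ?_
      split_ifs <;> simp
    have h1 := hg v (hAD v hv) hva
    have h2 := hg a (hAD a ha) fun i => mul_self_pos.mpr (ha0 i)
    rw [hc, hgc] at h1
    rw [hd, hgc] at h2
    set g := ∑ i, if 0 < a i then y i else 0
    have hd0 : d ≠ 0 := by rintro rfl; simp at h2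
    refine ⟨c / d, ?_, ?_⟩
    · have := mul_pos h1 h2
      have h3 : 0 < (c * d) * g ^ 2 := by
        rwa [show c * d * g ^ 2 = c * g * (d * g) by ring]
      have h4 : 0 < c * d := pos_of_mul_pos_left h3 (sq_nonneg _)
      have h5 : c / d = c * d / d ^ 2 := by field_simp
      rw [h5]; positivity
    · rw [hc, hd, smul_smul, div_mul_cancel₀ _ hd0]

theorem sum_pos_of_pos (hF : IsWeakMap F) {z : Fin 3 → ℝ} (hz : ∀ i, 0 < z i) :
    SumPos (F z) := by
  have hs : SumPos z := Finset.sum_pos (fun i _ => hz i) Finset.univ_nonempty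
  refine (hF.sum_nonneg z hs).lt_of_ne fun h => ?_
  have := (Finset.sum_eq_zero_iff_of_nonneg fun i _ => hF.coord_nonneg hs (hz i)).mp h.symm
  exact hF.ne_zero z hs (funext fun j => this j (Finset.mem_univ j))

/-- No nonempty open set is mapped to a plane. -/
theorem not_plane (hF : IsWeakMap F) {A : Set (Fin 3 → ℝ)} (hA : IsOpen A)
    (hne : A.Nonempty) (hAD : ∀ u ∈ A, SumPos u) {k : Fin 3 → ℝ} (hk : k ≠ 0)
    (hAk : ∀ u ∈ A, k ⬝ᵥ F u = 0) : False := by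
  set T : Set (Fin 3 → ℝ) := {z | ∀ i, 0 < z i} with hT
  have hTo : IsOpen T := by
    rw [hT, Set.ofPred_forall]
    exact isOpen_iInter_of_finite fun i => isOpen_lt continuous_const (by fun_prop)
  have h1T : (fun _ => 1 : Fin 3 → ℝ) ∈ T := fun i => one_pos
  have hTD : ∀ z ∈ T, SumPos z := fun z hz =>
    Finset.sum_pos (fun i _ => hz i) Finset.univ_nonempty
  have hTc : Convex ℝ T := by
    have : T = Set.univ.pi fun _ => Set.Ioi (0 : ℝ) := by ext z; simp [hT]
    rw [this]
    exact convex_pi fun _ _ => convex_Ioi 0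
  have hray : ∀ {A : Set (Fin 3 → ℝ)}, IsOpen A → A.Nonempty → (∀ u ∈ A, SumPos u) →
      ∀ {k : Fin 3 → ℝ}, k ≠ 0 → (∀ u ∈ A, k ⬝ᵥ F u = 0) →
      ∃ u ∈ A, ∃ A' ⊆ A, IsOpen A' ∧ A'.Nonempty ∧
        ∀ v ∈ A', ∃ c : ℝ, 0 < c ∧ F v = c • F u := by
    intro A hA hne hAD k hk hAk
    obtain ⟨u, hu, A', hA'A, hA', hne', hline⟩ := hF.exists_open_line hA hne hAD hk hAk
    obtain ⟨u', hu', A'', hA''A, h⟩ :=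
      hF.exists_open_ray hA' hne' (fun u hu => hAD u (hA'A hu)) hline
    exact ⟨u', hA'A hu', A'', hA''A.trans hA'A, h⟩
  have hTplane : ∀ {k : Fin 3 → ℝ}, k ≠ 0 → ¬∀ u ∈ T, k ⬝ᵥ F u = 0 := by
    intro k hk hTk
    obtain ⟨u, hu, A', hA'A, hA', hne', h⟩ := hray hTo ⟨_, h1T⟩ hTD hk hTk
    exact hF.not_finite_ray hA' hne' (fun v hv => hTD v (hA'A hv)) (hF.sum_pos_of_pos hu) h
  obtain ⟨u, hu, A', hA'A, hA', hne', h⟩ := hray hA hne hAD hk hAk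
  have hA'D : ∀ v ∈ A', SumPos v := fun v hv => hAD v (hA'A hv)
  -- A ray at finite distance is excluded by `not_finite_ray`. For a ray at infinity, the open
  -- triangle is mapped to vectors of positive sum, hence off its line; `plane_of_ray` then
  -- collapses the triangle to a plane, which `hTplane` forbids.
  rcases (hF.sum_nonneg u (hAD u hu)).eq_or_lt with h0 | h0
  · have hTy : ∀ x ∈ T, ¬∃ c : ℝ, F x = c • F u := by
      rintro x hx ⟨c, hc⟩
      have h1 : 0 < ∑ i, F x i := hF.sum_pos_of_pos hx
      have h2 : ∑ i, F x i = c * ∑ i, F u i := by rw [hc, Finset.mul_sum]; simp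
      rw [h2, ← h0, mul_zero] at h1
      exact lt_irrefl _ h1
    obtain ⟨w, hw⟩ := tripleProd.exists_ne_zero (hF.ne_zero u (hAD u hu)) (hTy _ h1T)
    obtain ⟨k', hk'⟩ := tripleProd.exists_normal (F u) (F fun _ => 1)
    refine hTplane (k := k') ?_ fun x hx => ?_
    · rintro rfl
      exact hw (by rw [hk']; simp)
    · rw [← hk']
      exact hF.plane_of_ray hA' hne' hA'D h hTo hTc.isPreconnected hTD hTy h1T hx
  · exact hF.not_finite_ray hA' hne' hA'D h0 h

theorem not_plane_of_tripleProd (hF : IsWeakMap F) {A : Set (Fin 3 → ℝ)} (hA : IsOpen A)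
    (hne : A.Nonempty) (hAD : ∀ u ∈ A, SumPos u) {p q w : Fin 3 → ℝ} (hw : tripleProd p q w ≠ 0)
    (hAk : ∀ u ∈ A, tripleProd p q (F u) = 0) : False := by
  obtain ⟨k, hk⟩ := tripleProd.exists_normal p q
  refine hF.not_plane hA hne hAD (k := k) ?_ fun u hu => by rw [← hk, hAk u hu]
  rintro rfl
  exact hw (by rw [hk]; simp)

/-! ### Rank three: strict preservation of orientation -/

/-- Independent vectors are mapped to independent vectors. -/
theorem not_parallel (hF : IsWeakMap F) {a b w : Fin 3 → ℝ} (ha : SumPos a) (hb : SumPos b)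
    (hw : tripleProd a b w ≠ 0) : ¬∃ c : ℝ, F b = c • F a := by
  rintro ⟨c, hc⟩
  have hc0 : c ≠ 0 := by
    rintro rfl
    exact hF.ne_zero b hb (by simpa using hc)
  have hFa := hF.ne_zero a ha
  -- Since `F b` is a multiple of `F a`, opposite sign demands on `[a u v]` and `c [b u v]` force
  -- `[F a, F u, F v] = 0` for an open set of `v`. By `not_plane_of_tripleProd`, `F u` is parallel
  -- to `F a`. This holds for all `u` off the plane of `a` and `b`, which is again a collapsed open
  -- set.
  have key : ∀ u, SumPos u → tripleProd a b u ≠ 0 → ∃ e : ℝ, F u = e • F a := by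
    intro u hu hab
    by_contra hn
    obtain ⟨w', hw'⟩ := tripleProd.exists_ne_zero hFa hn
    refine hF.not_plane_of_tripleProd (A := {v | SumPos v} ∩
      {v | 0 < tripleProd a u v ∧ 0 < -c * tripleProd b u v})
      (isOpen_sumPos.inter ((isOpen_lt continuous_const (tripleProd.continuous
      continuous_const continuous_const continuous_id)).inter (isOpen_lt continuous_const
      (continuous_const.mul (tripleProd.continuous continuous_const continuous_const
      continuous_id))))) ?_ (fun v hv => hv.1) hw' ?_
    · set x := -c * tripleProd b u a with hx
      set y := tripleProd a u b with hy
      have hu' : 0 < ∑ i, u i := hu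
      have hy0 : y ≠ 0 := by rw [hy, tripleProd.swap₂₃]; simpa using hab
      have hx0 : x ≠ 0 := by
        have : tripleProd b u a = tripleProd a b u := tripleProd.rot a b u
        rw [hx, this]
        exact mul_ne_zero (neg_ne_zero.mpr hc0) hab
      -- The coefficients `x` and `y` make the two determinants squares; the multiple of `u` does
      -- not affect them and normalizes the sum to one.
      refine ⟨x • a + y • b + ((1 - x * ∑ i, a i - y * ∑ i, b i) / ∑ i, u i) • u, ?_, ?_, ?_⟩
      · rw [Set.mem_ofPred_eq, SumPos, sum_combo]
        field_simp
        norm_num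
      · have : tripleProd a u (x • a + y • b +
            ((1 - x * ∑ i, a i - y * ∑ i, b i) / ∑ i, u i) • u) = y * y := by
          simp only [tripleProd.add₃, tripleProd.smul₃]
          simp [hy]
        rw [this]; exact mul_self_pos.mpr hy0
      · have : -c * tripleProd b u (x • a + y • b +
            ((1 - x * ∑ i, a i - y * ∑ i, b i) / ∑ i, u i) • u) = x * x := by
          simp only [tripleProd.add₃, tripleProd.smul₃]
          simp [hx]; ring
        rw [this]; exact mul_self_pos.mpr hx0
    · rintro v ⟨hv, hv1, hv2⟩
      have hv : SumPos v := hv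
      have h1 := hF.tripleProd_nonneg ha hu hv hv1
      have h2 : c * tripleProd (F b) (F u) (F v) ≤ 0 := by
        rcases lt_or_gt_of_ne hc0 with h | h
        · have := hF.tripleProd_nonneg hb hu hv (by nlinarith)
          nlinarith
        · have := hF.tripleProd_nonpos hb hu hv (by nlinarith)
          nlinarith
      rw [hc, tripleProd.smul₁, ← mul_assoc] at h2
      have : 0 < c * c := mul_self_pos.mpr hc0
      nlinarith
  obtain ⟨p, q, hpq⟩ := tripleProd.exists_pair_ne_zero hFa
  refine hF.not_plane_of_tripleProd (A := {v | SumPos v} ∩ {v | tripleProd a b v ≠ 0})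
    (isOpen_sumPos.inter (isOpen_ne_fun (tripleProd.continuous
      continuous_const continuous_const continuous_id) continuous_const)) ?_ (fun v hv => hv.1)
    hpq ?_
  · obtain ⟨t, ht, ht0⟩ :=
      ((eventually_add_smul_mem isOpen_sumPos (a := a) ha w).and self_mem_nhdsWithin).exists
    refine ⟨_, ht, ?_⟩
    change tripleProd a b (a + t • w) ≠ 0
    rw [tripleProd.add₃, tripleProd.smul₃, tripleProd.self₁₃, zero_add]
    exact mul_ne_zero (show (0:ℝ) < t from ht0).ne' hw
  · rintro v ⟨hv, hv'⟩
    obtain ⟨e, he⟩ := key v hv hv'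
    rw [he, tripleProd.smul₃]; simp

/-- Orientations are strictly preserved. -/
theorem tripleProd_pos (hF : IsWeakMap F) {a b c : Fin 3 → ℝ} (ha : SumPos a) (hb : SumPos b)
    (hc : SumPos c) (h : 0 < tripleProd a b c) : 0 < tripleProd (F a) (F b) (F c) := by
  refine (hF.tripleProd_nonneg ha hb hc h).lt_of_ne' fun h0 => ?_
  obtain ⟨w, hw⟩ := tripleProd.exists_ne_zero (hF.ne_zero a ha) (hF.not_parallel ha hb h.ne')
  -- If the images are dependent, `D • F c` is a combination of `F a`, with coefficient `α`, and of
  -- `F b`. Hence `D [F v, F b, F c] = -α [F a, F b, F v]`. Asking for `[a b v] > 0` and `α D [v b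
  -- c] > 0` makes both sides vanish on an open set.
  set D := tripleProd (F a) (F b) w with hD
  set α := tripleProd (F c) (F b) w with hα
  have hcr := tripleProd.cramer (F a) (F b) w (F c)
  rw [h0, zero_smul, add_zero, ← hD, ← hα] at hcr
  have hα0 : α ≠ 0 := by
    intro hα0
    rw [hα0, zero_smul, zero_add] at hcr
    refine hF.not_parallel hb hc (w := a) (by rw [tripleProd.rot]; exact h.ne')
      ⟨D⁻¹ * tripleProd (F a) (F c) w, ?_⟩
    rw [mul_smul, ← hcr, smul_smul, inv_mul_cancel₀ hw, one_smul]
  have hprod : α * D ≠ 0 := mul_ne_zero hα0 hw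
  refine hF.not_plane_of_tripleProd (A := {v | SumPos v} ∩
      {v | 0 < tripleProd a b v ∧ 0 < α * D * tripleProd v b c})
      (isOpen_sumPos.inter ((isOpen_lt continuous_const (tripleProd.continuous
      continuous_const continuous_const continuous_id)).inter (isOpen_lt continuous_const
      (continuous_const.mul (tripleProd.continuous continuous_id continuous_const
      continuous_const))))) ?_ (fun v hv => hv.1) hw ?_
  · have hb' : 0 < ∑ i, b i := hb
    -- The `b` term leaves both determinants alone and makes the sum equal to one; they become `[a b
    -- c]` and `(α D)² [a b c]`.
    refine ⟨(α * D) • a + ((1 - (α * D) * ∑ i, a i - 1 * ∑ i, c i) / ∑ i, b i) • b + (1:ℝ) • c,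
      ?_, ?_, ?_⟩
    · rw [Set.mem_ofPred_eq, SumPos, sum_combo, div_mul_cancel₀ _ hb'.ne']
      linarith
    · simp only [tripleProd.add₃, tripleProd.smul₃, tripleProd.self₁₃, tripleProd.self₂₃]
      simpa using h
    · simp only [tripleProd.add₁, tripleProd.smul₁, tripleProd.self₁₃, tripleProd.self₁₂]
      have := mul_pos (mul_self_pos.mpr hprod) h
      simp only [mul_zero, add_zero]
      rw [← mul_assoc]; exact this
  · rintro v ⟨hv, hv1, hv2⟩
    have hv : SumPos v := hv
    have h1 := hF.tripleProd_nonneg ha hb hv hv1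
    have h2 : 0 ≤ α * D * tripleProd (F v) (F b) (F c) := by
      rcases lt_or_gt_of_ne hprod with h | h
      · have := hF.tripleProd_nonpos hv hb hc (by nlinarith)
        nlinarith
      · have := hF.tripleProd_nonneg hv hb hc (by nlinarith)
        nlinarith
    have h3 : D * tripleProd (F v) (F b) (F c) = -(α * tripleProd (F a) (F b) (F v)) := by
      rw [← tripleProd.smul₃, hcr, tripleProd.add₃, tripleProd.smul₃, tripleProd.smul₃,
        tripleProd.self₂₃]
      unfold tripleProd; ring
    rw [mul_assoc, h3] at h2
    have h4 : 0 < α * α := mul_self_pos.mpr hα0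
    nlinarith

end IsWeakMap

/-! ### From an open set to all points -/

section Extension

variable {I : Type*} [Fintype I] [DecidableEq I]

/-- Adding multiples of row `i₁` changes no determinant. This allows every row except `i₀` to be
moved close to the point `r i₁` while the sign of the determinant stays under control. -/
theorem det_translate_rows (r : I → I → ℝ) {i₀ i₁ : I} (v : I → ℝ) (h₀ : v i₀ = 1)
    (h₁ : v i₁ = 1) :
    (Matrix.of fun k => if k = i₀ ∨ k = i₁ then r k else r i₁ + v k • r k).det =
      (∏ k, v k) * (Matrix.of r).det := by
  rw [← Matrix.det_mul_column]
  refine Matrix.det_eq_of_forall_row_eq_smul_add_const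
    (fun k => if k = i₀ ∨ k = i₁ then 0 else 1) i₁ (by simp) fun k j => ?_
  by_cases h : k = i₀ ∨ k = i₁
  · have : v k = 1 := by rcases h with rfl | rfl <;> assumption
    simp [h, this]
  · simp [h, h₁]; ring

theorem exists_rows {z t w : I → ℝ} (h : LinearIndependent ℝ ![z, t, w]) :
    ∃ (r : I → I → ℝ) (i₀ i₁ i₂ : I), i₀ ≠ i₁ ∧ i₀ ≠ i₂ ∧ i₁ ≠ i₂ ∧ r i₀ = z ∧ r i₁ = t ∧
      r i₂ = w ∧ (Matrix.of r).det ≠ 0 := by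
  set b := Module.Basis.sumExtend h with hb
  set e := b.indexEquiv (Pi.basisFun ℝ I)
  have hbi : ∀ i, b (Sum.inl i) = ![z, t, w] i := fun i => by
    simp only [hb, Module.Basis.sumExtend, Module.Basis.reindex_apply, Module.Basis.coe_extend]
    rfl
  refine ⟨b.reindex e, e (Sum.inl 0), e (Sum.inl 1), e (Sum.inl 2), by simp, by simp, by simp,
    ?_, ?_, ?_, ?_⟩
  · simp [hbi]
  · simp [hbi]
  · simp [hbi]
  · have := (Matrix.linearIndependent_rows_iff_isUnit (A := Matrix.of (b.reindex e))).mp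
      (b.reindex e).linearIndependent
    exact ((Matrix.isUnit_iff_isUnit_det _).mp this).ne_zero

/-- A weakly orientation preserving map that fixes an open set projectively fixes every point. -/
theorem eq_smul_of_eq_smul_on_open (hI : 3 ≤ Fintype.card I) {F : (I → ℝ) → I → ℝ}
    (hne : ∀ z, 0 < ∑ i, z i → F z ≠ 0)
    (hdet : ∀ z : I → I → ℝ, (∀ i, 0 < ∑ j, z i j) → 0 < (Matrix.of z).det →
      0 ≤ (Matrix.of fun i => F (z i)).det)
    (hpos : ∀ z, 0 < ∑ i, z i → ∀ c : ℝ, F z = c • z → 0 ≤ c)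
    {U : Set (I → ℝ)} (hU : IsOpen U) (hUne : U.Nonempty) (hUD : ∀ t ∈ U, 0 < ∑ i, t i)
    (hUF : ∀ t ∈ U, ∃ c : ℝ, 0 < c ∧ F t = c • t) {z : I → ℝ} (hz : 0 < ∑ i, z i) :
    ∃ c : ℝ, 0 < c ∧ F z = c • z := by
  have hdep : ∀ t ∈ U, ¬LinearIndependent ℝ ![z, t, F z] := by
    intro t ht hli
    obtain ⟨r, i₀, i₁, i₂, h01, h02, h12, hr0, hr1, hr2, hdr⟩ := exists_rows hli
    set δ := (Matrix.of r).det
    -- Row `i₂` becomes `F z + z`, so the face formed by the rows other than `i₀` separates `z` from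
    -- `F z`: putting `F z` for `z` in row `i₀` changes the determinant from `δ` to `-δ`. With that
    -- face shrunk towards `t` inside `U`, where `F` is projectively the identity, `F` would reverse
    -- an orientation.
    set s : I → I → ℝ := Function.update r i₂ (r i₂ + r i₀) with hs
    set s' : I → I → ℝ := Function.update s i₀ (r i₂) with hs'
    have hds : (Matrix.of s).det = δ := by
      have := Matrix.det_updateRow_add_smul_self (Matrix.of r) h02.symm 1
      rw [one_smul] at this
      exact this
    have hds' : (Matrix.of s').det = -δ := by
      have h1 := Matrix.det_permute (Equiv.swap i₀ i₂) (Matrix.of r)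
      rw [Equiv.Perm.sign_swap h02] at h1
      simp only [Units.val_neg, Units.val_one, Int.cast_neg, Int.cast_one, neg_one_mul] at h1
      have h2 := Matrix.det_updateRow_add_smul_self
        ((Matrix.of r).submatrix (Equiv.swap i₀ i₂) id) h02.symm 1
      rw [h1] at h2
      rw [← h2]
      congr 1
      ext k j
      by_cases hk2 : k = i₂
      · subst hk2
        simp [hs', hs, h02.symm]; ring
      · by_cases hk0 : k = i₀
        · subst hk0
          simp [hs', hk2]
        · simp [hs', hs, hk2, hk0, Equiv.swap_apply_of_ne_of_ne hk0 hk2]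
    -- The factor `δ` in row `i₂` makes the determinant of the shrunken simplex positive whatever
    -- the sign of `δ`.
    set σ : I → ℝ := fun k => if k = i₂ then δ else 1 with hσ
    obtain ⟨ε, hε, hε0⟩ : ∃ ε : ℝ, (∀ k, t + (ε * σ k) • s k ∈ U) ∧ 0 < ε := by
      have : ∀ k, ∀ᶠ ε : ℝ in 𝓝[>] 0, t + (ε * σ k) • s k ∈ U := by
        intro k
        have hc : Continuous fun ε : ℝ => t + (ε * σ k) • s k := by fun_prop
        exact (hc.continuousAt.eventually_mem (hU.mem_nhds (by simpa using ht))).filter_mono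
          nhdsWithin_le_nhds
      obtain ⟨ε, h, h'⟩ := ((eventually_all.mpr this).and self_mem_nhdsWithin).exists
      exact ⟨ε, h, h'⟩
    set v : I → ℝ := fun k => if k = i₀ ∨ k = i₁ then 1 else ε * σ k with hv
    have hv2 : v i₂ = ε * δ := by simp [hv, hσ, h02.symm, h12.symm]
    have hvk : ∀ k, k ≠ i₂ → 0 < v k := by
      intro k hk
      by_cases h : k = i₀ ∨ k = i₁ <;> simp [hv, hσ, h, hk, hε0]
    have hprod : 0 < (∏ k, v k) * δ := by
      rw [← Finset.mul_prod_erase _ _ (Finset.mem_univ i₂), hv2]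
      have h1 : 0 < ∏ k ∈ Finset.univ.erase i₂, v k :=
        Finset.prod_pos fun k hk => hvk k (Finset.ne_of_mem_erase hk)
      have h2 : 0 < δ * δ := mul_self_pos.mpr hdr
      have := mul_pos hε0 (mul_pos h1 h2)
      rw [show ε * δ * (∏ k ∈ Finset.univ.erase i₂, v k) * δ =
        ε * ((∏ k ∈ Finset.univ.erase i₂, v k) * (δ * δ)) by ring]
      exact this
    have hs0 : s i₀ = z := by simp [hs, h02, hr0]
    have hs1 : s i₁ = t := by simp [hs, h12, hr1]
    have hs'1 : s' i₁ = t := by simp [hs', h01.symm, hs1]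
    have hs'0 : s' i₀ = F z := by simp [hs', hr2]
    set A : I → I → ℝ := fun k => if k = i₀ ∨ k = i₁ then s k else s i₁ + v k • s k with hA
    have hA0 : A i₀ = z := by simp [hA, hs0]
    have hAU : ∀ k, k ≠ i₀ → A k ∈ U := by
      intro k hk
      by_cases hk1 : k = i₁
      · simpa [hA, hk1, hs1] using ht
      · have := hε k
        simpa [hA, hk, hk1, hs1, hv] using this
    have hAD : ∀ k, 0 < ∑ j, A k j := by
      intro k
      by_cases hk : k = i₀
      · rw [hk, hA0]; exact hz
      · exact hUD _ (hAU k hk)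
    have hdetA : (Matrix.of A).det = (∏ k, v k) * δ := by
      rw [hA, det_translate_rows s v (by simp [hv]) (by simp [hv]), hds]
    have hFA : ∀ k, ∃ c : ℝ, 0 < c ∧
        F (A k) = c • (if k = i₀ ∨ k = i₁ then s' k else s' i₁ + v k • s' k) := by
      intro k
      by_cases hk : k = i₀
      · subst hk
        exact ⟨1, one_pos, by simp [hA0, hs'0]⟩
      · obtain ⟨c, hc, h⟩ := hUF _ (hAU k hk)
        refine ⟨c, hc, ?_⟩
        have : s' k = s k := by simp [hs', hk]
        rw [h, hs'1, this, hA, hs1]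
    choose c hc hcA using hFA
    have h1 := hdet A hAD (by rw [hdetA]; exact hprod)
    have h2 : (Matrix.of fun k => F (A k)).det = (∏ k, c k) * ((∏ k, v k) * -δ) := by
      rw [← hds', ← det_translate_rows (i₀ := i₀) (i₁ := i₁) s' v (by simp [hv]) (by simp [hv]),
        ← Matrix.det_mul_column]
      congr 1
      ext k j
      simp [hcA k]
    rw [h2] at h1
    have h3 : 0 < ∏ k, c k := Finset.prod_pos fun k _ => hc k
    nlinarith [mul_pos h3 hprod]
  have hz0 : z ≠ 0 := by rintro rfl; simp at hz
  -- In dimension at least three an open set is not contained in a span of two vectors. With `t`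
  -- outside the span of `z` and `F z`, the dependence of `z`, `t`, `F z` must be one of `z` and `F
  -- z`.
  obtain ⟨t, ht, htn⟩ : ∃ t ∈ U, t ∉ Submodule.span ℝ {z, F z} := by
    by_contra! h
    have htop := Submodule.eq_top_of_nonempty_interior' (Submodule.span ℝ {z, F z})
      (hUne.mono (interior_maximal h hU))
    have h1 := finrank_span_finset_le_card (R := ℝ) ({z, F z} : Finset (I → ℝ))
    have h2 : ({z, F z} : Finset (I → ℝ)).card ≤ 2 := Finset.card_le_two
    rw [Set.finrank, Finset.coe_pair, htop, finrank_top, Module.finrank_fintype_fun_eq_card] at h1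
    omega
  have hex : ∃ c : ℝ, F z = c • z := by
    by_contra hn
    refine hdep t ht ?_
    have hli : LinearIndependent ℝ ![z, F z] := by
      rw [LinearIndependent.pair_iff' hz0]
      exact fun a ha => hn ⟨a, ha.symm⟩
    have h3 : LinearIndependent ℝ (Fin.cons t ![z, F z] : Fin 3 → I → ℝ) :=
      linearIndependent_finCons.mpr ⟨hli, by
        simpa [Matrix.range_cons, Set.pair_comm] using htn⟩
    have := h3.comp ![1, 0, 2] (by decide)
    convert this using 1
    ext k j
    fin_cases k <;> rfl
  obtain ⟨c, hc⟩ := hex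
  refine ⟨c, (hpos z hz c hc).lt_of_ne' ?_, hc⟩
  rintro rfl
  exact hne z hz (by simpa using hc)

end Extension

/-! ### A functional equation for monotone functions -/

/-- A monotone function whose increments depend monotonically on the step alone is affine. -/
theorem exists_affine_of_increments {g : ℝ → ℝ} (hg : Monotone g)
    (h : ∀ x₁ x₂ d₁ d₂, d₁ < d₂ → g (x₁ + d₁) - g x₁ ≤ g (x₂ + d₂) - g x₂) :
    ∃ α κ : ℝ, ∀ x, g x = α * x + κ := by
  obtain ⟨x₀, hx₀⟩ : ∃ x₀, ContinuousAt g x₀ := by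
    by_contra! hn
    have : {x | ¬ContinuousAt g x} = Set.univ := Set.eq_univ_of_forall hn
    have hc := hg.countable_not_continuousAt
    rw [this] at hc
    exact Set.not_countable_univ hc
  have hx₀' : Tendsto (fun d => g (x₀ + d) - g x₀) (𝓝 0) (𝓝 0) := by
    have h1 : Tendsto (fun d : ℝ => x₀ + d) (𝓝 0) (𝓝 x₀) := by
      have : Continuous fun d : ℝ => x₀ + d := by fun_prop
      simpa using this.tendsto 0
    simpa using (hx₀.tendsto.comp h1).sub_const (g x₀)
  -- Continuity at `x₀` spreads to every point: for `d ≠ 0`, `d - |d| < d < d + |d|`, so increments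
  -- at `x` are squeezed between increments at `x₀`.
  have hcont : ∀ x, Tendsto (fun d => g (x + d) - g x) (𝓝 0) (𝓝 0) := by
    intro x
    have hu : Tendsto (fun d : ℝ => g (x₀ + (d + |d|)) - g x₀) (𝓝 0) (𝓝 0) := by
      have : Continuous fun d : ℝ => d + |d| := by fun_prop
      exact hx₀'.comp (by simpa using this.tendsto 0)
    have hl : Tendsto (fun d : ℝ => g (x₀ + (d - |d|)) - g x₀) (𝓝 0) (𝓝 0) := by
      have : Continuous fun d : ℝ => d - |d| := by fun_prop
      exact hx₀'.comp (by simpa using this.tendsto 0)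
    refine tendsto_of_tendsto_of_tendsto_of_le_of_le hl hu (fun d => ?_) fun d => ?_
    · rcases eq_or_ne d 0 with rfl | hd
      · simp
      · exact h _ _ _ _ (by have := abs_pos.mpr hd; linarith)
    · rcases eq_or_ne d 0 with rfl | hd
      · simp
      · exact h _ _ _ _ (by have := abs_pos.mpr hd; linarith)
  have hgc : Continuous g := by
    rw [continuous_iff_continuousAt]
    intro x
    have h1 : Tendsto (fun y => y - x) (𝓝 x) (𝓝 0) := by
      have : Continuous fun y : ℝ => y - x := by fun_prop
      simpa using this.tendsto x
    have h2 := ((hcont x).comp h1).add_const (g x)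
    simpa [Function.comp_def, ContinuousAt] using h2
  have hle : ∀ x₁ x₂ d, g (x₁ + d) - g x₁ ≤ g (x₂ + d) - g x₂ := by
    intro x₁ x₂ d
    have h1 : Tendsto (fun e => g (x₂ + e) - g x₂) (𝓝[>] d) (𝓝 (g (x₂ + d) - g x₂)) := by
      have : Continuous fun e => g (x₂ + e) - g x₂ := by fun_prop
      exact (this.tendsto d).mono_left nhdsWithin_le_nhds
    refine ge_of_tendsto h1 ?_
    filter_upwards [self_mem_nhdsWithin] with e he
    exact h _ _ _ _ he
  -- By `hle`, used in both directions, increments do not depend on the base point; this is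
  -- additivity, and continuity makes it linear.
  let φ : ℝ →+ ℝ := AddMonoidHom.mk' (fun d => g d - g 0) fun a b => by
    have h1 := hle a 0 b
    have h2 := hle 0 a b
    simp only [zero_add] at h1 h2
    linarith
  have hφ : Continuous φ := by
    change Continuous fun d => g d - g 0
    fun_prop
  refine ⟨φ 1, g 0, fun x => ?_⟩
  have h1 : φ x = x * φ 1 := by
    have := map_real_smul φ hφ x 1
    simpa using this
  have h2 : φ x = g x - g 0 := rfl
  linarith

/-- Two functions that depend strictly monotonically on coordinates `a`, respectively `b`, alone,
and whose sum depends strictly monotonically on `a + b` alone, are affine with the same slope. -/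
theorem exists_affine_of_strictMono_pencils {Ω : Type*} {a b A B : Ω → ℝ}
    (hab : ∀ x y, ∃ ω, a ω = x ∧ b ω = y)
    (hA : ∀ ω ω', a ω < a ω' → A ω < A ω') (hB : ∀ ω ω', b ω < b ω' → B ω < B ω')
    (hAB : ∀ ω ω', a ω + b ω < a ω' + b ω' → A ω + B ω < A ω' + B ω') :
    ∃ α κ κ' : ℝ, 0 < α ∧ ∀ ω, A ω = α * a ω + κ ∧ B ω = α * b ω + κ' := by
  have key : ∀ {a b A B : Ω → ℝ}, (∀ x y, ∃ ω, a ω = x ∧ b ω = y) →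
      (∀ ω ω', a ω < a ω' → A ω < A ω') → (∀ ω ω', b ω < b ω' → B ω < B ω') →
      (∀ ω ω', a ω + b ω < a ω' + b ω' → A ω + B ω < A ω' + B ω') →
      ∃ α κ : ℝ, ∀ ω, A ω = α * a ω + κ := by
    intro a b A B hab hA hB hAB
    choose p hpa hpb using hab
    -- The hypotheses say nothing about points with equal coordinates, so the comparison passes
    -- through points shifted by `ε`. The gap is `8 ε` and the shifts use up only `4 ε` of it.
    have hM : ∀ x y x' y', x + y < x' + y' →
        A (p x 0) + B (p 0 y) ≤ A (p x' 0) + B (p 0 y') := by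
      intro x y x' y' h
      set ε := (x' + y' - x - y) / 8 with hε
      have h1 := hA (p x 0) (p (x + ε) (y + ε)) (by rw [hpa, hpa]; linarith)
      have h2 := hB (p 0 y) (p (x + ε) (y + ε)) (by rw [hpb, hpb]; linarith)
      have h3 := hAB (p (x + ε) (y + ε)) (p (x' - ε) (y' - ε))
        (by rw [hpa, hpa, hpb, hpb]; linarith)
      have h4 := hA (p (x' - ε) (y' - ε)) (p x' 0) (by rw [hpa, hpa]; linarith)
      have h5 := hB (p (x' - ε) (y' - ε)) (p 0 y') (by rw [hpb, hpb]; linarith)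
      linarith
    have hmono : Monotone fun x => A (p x 0) := by
      intro x x' h
      rcases h.eq_or_lt with rfl | h
      · rfl
      · exact (hA _ _ (by rw [hpa, hpa]; exact h)).le
    obtain ⟨α, κ, hακ⟩ := exists_affine_of_increments hmono fun x₁ x₂ d₁ d₂ hd => by
      have h1 := hM (x₁ + d₁) 0 x₁ ((d₁ + d₂) / 2) (by linarith)
      have h2 := hM x₂ ((d₁ + d₂) / 2) (x₂ + d₂) 0 (by linarith)
      linarith
    refine ⟨α, κ, fun ω => ?_⟩
    -- The formula is known only along the chosen points `p x 0`; strict comparison from both sides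
    -- squeezes `A ω` to the same value.
    have hlim : Tendsto (fun x : ℝ => α * x + κ) (𝓝 (a ω)) (𝓝 (α * a ω + κ)) := by
      have : Continuous fun x : ℝ => α * x + κ := by fun_prop
      exact this.tendsto (a ω)
    refine le_antisymm (ge_of_tendsto (hlim.mono_left (nhdsWithin_le_nhds (s := Set.Ioi (a ω)))) ?_)
      (le_of_tendsto (hlim.mono_left (nhdsWithin_le_nhds (s := Set.Iio (a ω)))) ?_)
    · filter_upwards [self_mem_nhdsWithin] with x hx
      rw [← hακ]; exact (hA _ _ (by rw [hpa]; exact hx)).le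
    · filter_upwards [self_mem_nhdsWithin] with x hx
      rw [← hακ]; exact (hA _ _ (by rw [hpa]; exact hx)).le
  obtain ⟨α, κ, h1⟩ := key hab hA hB hAB
  obtain ⟨β, κ', h2⟩ := key (fun x y => (hab y x).imp fun _ h => h.symm) hB hA
    (fun ω ω' h => by have := hAB ω ω' (by linarith); linarith)
  choose p hpa hpb using hab
  have hα : 0 < α := by
    have := hA (p 0 0) (p 1 0) (by rw [hpa, hpa]; exact one_pos)
    rw [h1, h1, hpa, hpa] at this
    linarith
  have hs : ∀ x x' y y', x + y < x' + y' → α * x + β * y < α * x' + β * y' := by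
    intro x x' y y' h
    have := hAB (p x y) (p x' y') (by rw [hpa, hpa, hpb, hpb]; exact h)
    rw [h1, h1, h2, h2, hpa, hpa, hpb, hpb] at this
    linarith
  have hαβ : α = β := by
    refine le_antisymm ?_ ?_
    · refine le_of_forall_pos_lt_add fun ε hε => ?_
      have hβ : 0 < |β| + 1 := by positivity
      have := hs 1 0 0 (1 + ε / (|β| + 1)) (by have : 0 < ε / (|β| + 1) := by positivity
                                               linarith)
      have h3 : β * (ε / (|β| + 1)) ≤ ε := by
        rw [mul_div_assoc', div_le_iff₀ hβ]
        nlinarith [le_abs_self β]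
      nlinarith
    · refine le_of_forall_pos_lt_add fun ε hε => ?_
      have := hs 0 (1 + ε / α) 1 0 (by have : 0 < ε / α := by positivity
                                       linarith)
      have h3 : α * (ε / α) = ε := by field_simp
      nlinarith
  exact ⟨α, κ, κ', hα, fun ω => ⟨h1 ω, by rw [hαβ]; exact h2 ω⟩⟩

/-- The mean value inequality for powers is an equality only for the exponent one. -/
theorem rpow_mean_eq {α : ℝ} (hα : 0 < α) (h : 1 + (3 : ℝ) ^ α = 2 * (2 : ℝ) ^ α) : α = 1 := by
  have hmid : (2⁻¹ : ℝ) • (1 : ℝ) + (2⁻¹ : ℝ) • (3 : ℝ) = 2 := by norm_num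
  have e : (2⁻¹ : ℝ) • ((1 : ℝ) ^ α) + (2⁻¹ : ℝ) • ((3 : ℝ) ^ α) = 2 ^ α := by
    rw [Real.one_rpow, smul_eq_mul, smul_eq_mul]; linarith
  have m1 : (1 : ℝ) ∈ Set.Ici (0 : ℝ) := by simp
  have m3 : (3 : ℝ) ∈ Set.Ici (0 : ℝ) := by simp
  have hh : (0 : ℝ) < 2⁻¹ := by norm_num
  have h13 : (1 : ℝ) ≠ 3 := by norm_num
  have hs : (2⁻¹ : ℝ) + 2⁻¹ = 1 := by norm_num
  rcases lt_trichotomy α 1 with h1 | h1 | h1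
  · have := (Real.strictConcaveOn_rpow hα h1).2 m1 m3 h13 hh hh hs
    rw [hmid, e] at this
    exact absurd this (lt_irrefl _)
  · exact h1
  · have := (strictConvexOn_rpow h1).2 m1 m3 h13 hh hh hs
    rw [hmid, e] at this
    exact absurd this (lt_irrefl _)

/-! ### Rank three: the open triangle and rigidity -/

namespace IsWeakMap

variable {F : (Fin 3 → ℝ) → Fin 3 → ℝ}

/-- On the open coordinate triangle, the map is a power map in homogeneous coordinates. -/
theorem exists_power (hF : IsWeakMap F) : ∃ (α : ℝ) (c : Fin 3 → ℝ), 0 < α ∧ (∀ i, 0 < c i) ∧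
    ∀ z : Fin 3 → ℝ, (∀ i, 0 < z i) → ∃ l : ℝ, 0 < l ∧ ∀ i, F z i = l * (c i * z i ^ α) := by
  have hs : ∀ i : Fin 3, SumPos (Pi.single i 1) := fun i => by simp [SumPos]
  have hD : ∀ z : Fin 3 → ℝ, (∀ i, 0 < z i) → SumPos z := fun z hz =>
    Finset.sum_pos (fun i _ => hz i) Finset.univ_nonempty
  have hFpos : ∀ z : Fin 3 → ℝ, (∀ i, 0 < z i) → ∀ i, 0 < F z i := by
    intro z hz i
    have h := hF.tripleProd_pos (hD z hz) (hs (i + 1)) (hs (i + 2))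
      (by fin_cases i <;> simpa [tripleProd] using hz _)
    rw [hF.fix, hF.fix] at h
    fin_cases i <;> simpa [tripleProd] using h
  -- The ratio of two coordinates labels the lines through the opposite vertex, and the determinant
  -- of two points with that vertex compares the labels. The three pencils give three monotone
  -- ratios, and the logarithms of two of them add up to that of the third.
  have h01 : ∀ z z' : Fin 3 → ℝ, (∀ i, 0 < z i) → (∀ i, 0 < z' i) → z 0 / z 1 < z' 0 / z' 1 →
      F z 0 / F z 1 < F z' 0 / F z' 1 := by
    intro z z' hz hz' h
    rw [div_lt_div_iff₀ (hz 1) (hz' 1)] at h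
    rw [div_lt_div_iff₀ (hFpos z hz 1) (hFpos z' hz' 1)]
    have := hF.tripleProd_pos (hD z' hz') (hD z hz) (hs 2)
      (by simp [tripleProd]; linarith)
    rw [hF.fix] at this
    simp [tripleProd] at this
    linarith
  have h12 : ∀ z z' : Fin 3 → ℝ, (∀ i, 0 < z i) → (∀ i, 0 < z' i) → z 1 / z 2 < z' 1 / z' 2 →
      F z 1 / F z 2 < F z' 1 / F z' 2 := by
    intro z z' hz hz' h
    rw [div_lt_div_iff₀ (hz 2) (hz' 2)] at h
    rw [div_lt_div_iff₀ (hFpos z hz 2) (hFpos z' hz' 2)]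
    have := hF.tripleProd_pos (hs 0) (hD z' hz') (hD z hz)
      (by simp [tripleProd]; linarith)
    rw [hF.fix] at this
    simp [tripleProd] at this
    linarith
  have h02 : ∀ z z' : Fin 3 → ℝ, (∀ i, 0 < z i) → (∀ i, 0 < z' i) → z 0 / z 2 < z' 0 / z' 2 →
      F z 0 / F z 2 < F z' 0 / F z' 2 := by
    intro z z' hz hz' h
    rw [div_lt_div_iff₀ (hz 2) (hz' 2)] at h
    rw [div_lt_div_iff₀ (hFpos z hz 2) (hFpos z' hz' 2)]
    have := hF.tripleProd_pos (hD z' hz') (hs 1) (hD z hz)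
      (by simp [tripleProd]; linarith)
    rw [hF.fix] at this
    simp [tripleProd] at this
    linarith
  have hlog : ∀ x y z : ℝ, 0 < x → 0 < y → 0 < z →
      Real.log (x / y) + Real.log (y / z) = Real.log (x / z) := by
    intro x y z hx hy hz
    rw [Real.log_div hx.ne' hy.ne', Real.log_div hy.ne' hz.ne', Real.log_div hx.ne' hz.ne']
    ring
  have hll : ∀ x y : ℝ, 0 < x → 0 < y → (Real.log x < Real.log y ↔ x < y) :=
    fun x y hx hy => Real.log_lt_log_iff hx hy
  obtain ⟨α, κ, κ', hα, h⟩ := exists_affine_of_strictMono_pencils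
    (Ω := {z : Fin 3 → ℝ // ∀ i, 0 < z i})
    (a := fun z => Real.log (z.1 0 / z.1 1)) (b := fun z => Real.log (z.1 1 / z.1 2))
    (A := fun z => Real.log (F z.1 0 / F z.1 1)) (B := fun z => Real.log (F z.1 1 / F z.1 2))
    (fun x y => ⟨⟨![Real.exp (x + y), Real.exp y, 1], fun i => by
      fin_cases i <;> simp [Real.exp_pos]⟩, by
        simp [← Real.exp_sub], by simp⟩)
    (fun ω ω' h => by
      obtain ⟨z, hz⟩ := ω
      obtain ⟨z', hz'⟩ := ω'
      simp only at h ⊢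
      rw [hll _ _ (div_pos (hz 0) (hz 1)) (div_pos (hz' 0) (hz' 1))] at h
      rw [hll _ _ (div_pos (hFpos z hz 0) (hFpos z hz 1))
        (div_pos (hFpos z' hz' 0) (hFpos z' hz' 1))]
      exact h01 z z' hz hz' h)
    (fun ω ω' h => by
      obtain ⟨z, hz⟩ := ω
      obtain ⟨z', hz'⟩ := ω'
      simp only at h ⊢
      rw [hll _ _ (div_pos (hz 1) (hz 2)) (div_pos (hz' 1) (hz' 2))] at h
      rw [hll _ _ (div_pos (hFpos z hz 1) (hFpos z hz 2))
        (div_pos (hFpos z' hz' 1) (hFpos z' hz' 2))]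
      exact h12 z z' hz hz' h)
    (fun ω ω' h => by
      obtain ⟨z, hz⟩ := ω
      obtain ⟨z', hz'⟩ := ω'
      simp only at h ⊢
      rw [hlog _ _ _ (hz 0) (hz 1) (hz 2), hlog _ _ _ (hz' 0) (hz' 1) (hz' 2),
        hll _ _ (div_pos (hz 0) (hz 2)) (div_pos (hz' 0) (hz' 2))] at h
      rw [hlog _ _ _ (hFpos z hz 0) (hFpos z hz 1) (hFpos z hz 2),
        hlog _ _ _ (hFpos z' hz' 0) (hFpos z' hz' 1) (hFpos z' hz' 2),
        hll _ _ (div_pos (hFpos z hz 0) (hFpos z hz 2))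
        (div_pos (hFpos z' hz' 0) (hFpos z' hz' 2))]
      exact h02 z z' hz hz' h)
  have hpow : ∀ x y X Y k : ℝ, 0 < x → 0 < y → 0 < X → 0 < Y →
      Real.log (X / Y) = α * Real.log (x / y) + k →
      X = Real.exp k * x ^ α / y ^ α * Y := by
    intro x y X Y k hx hy hX hY h
    have h1 : X / Y = Real.exp k * (x ^ α / y ^ α) := by
      rw [← Real.div_rpow hx.le hy.le, Real.rpow_def_of_pos (div_pos hx hy), ← Real.exp_add,
        ← Real.exp_log (div_pos hX hY), h]
      congr 1; ring
    rw [div_eq_iff hY.ne'] at h1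
    rw [h1]; ring
  refine ⟨α, ![Real.exp (κ + κ'), Real.exp κ', 1], hα,
    fun i => by fin_cases i <;> simp [Real.exp_pos], fun z hz => ?_⟩
  obtain ⟨h1, h2⟩ := h ⟨z, hz⟩
  simp only at h1 h2
  have hz2 : 0 < z 2 ^ α := Real.rpow_pos_of_pos (hz 2) α
  have hz1 : 0 < z 1 ^ α := Real.rpow_pos_of_pos (hz 1) α
  have e1 := hpow _ _ _ _ _ (hz 1) (hz 2) (hFpos z hz 1) (hFpos z hz 2) h2
  have e0 := hpow _ _ _ _ _ (hz 0) (hz 1) (hFpos z hz 0) (hFpos z hz 1) h1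
  refine ⟨F z 2 / z 2 ^ α, div_pos (hFpos z hz 2) hz2, fun i => ?_⟩
  fin_cases i
  · simp only [Fin.zero_eta, Matrix.cons_val_zero]
    rw [e0, e1, Real.exp_add]
    field_simp
  · simp only [Fin.mk_one, Matrix.cons_val_one, Matrix.cons_val_zero]
    rw [e1]
    field_simp
  · simp only [Fin.reduceFinMk, Matrix.cons_val]
    field_simp

/-- On the open coordinate triangle, the map is a diagonal projective map. -/
theorem exists_diagonal (hF : IsWeakMap F) : ∃ c : Fin 3 → ℝ, (∀ i, 0 < c i) ∧
    ∀ z : Fin 3 → ℝ, (∀ i, 0 < z i) → ∃ l : ℝ, 0 < l ∧ ∀ i, F z i = l * (c i * z i) := by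
  obtain ⟨α, c, hα, hc, h⟩ := hF.exists_power
  have hD : ∀ z : Fin 3 → ℝ, (∀ i, 0 < z i) → SumPos z := fun z hz =>
    Finset.sum_pos (fun i _ => hz i) Finset.univ_nonempty
  have p1 : ∀ i, (0 : ℝ) < ![1, 2, 3] i := fun i => by fin_cases i <;> simp
  have p3 : ∀ i, (0 : ℝ) < ![3, 2, 1] i := fun i => by fin_cases i <;> simp
  set X := (2 : ℝ) ^ α
  set Y := (3 : ℝ) ^ α
  have hY : 1 < Y := Real.one_lt_rpow (by norm_num) hα
  obtain ⟨l₁, hl₁, e1⟩ := h _ p1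
  obtain ⟨l₃, hl₃, e3⟩ := h _ p3
  -- The vector `![1, m, 1]` is coplanar with `![1, 2, 3]` and `![3, 2, 1]` exactly for `m = 1`. The
  -- weak sign conditions for `m` on either side of one give, in the limit, `1 + 3 ^ α = 2 * 2 ^ α`.
  have key : ∀ m : ℝ, 0 < m → ∃ C : ℝ, 0 < C ∧
      tripleProd (F ![1, 2, 3]) (F ![1, m, 1]) (F ![3, 2, 1]) =
        -C * (m ^ α * (1 + Y) - 2 * X) ∧
      tripleProd ![1, 2, 3] ![1, m, 1] ![3, 2, 1] = -8 * (m - 1) ∧ SumPos ![1, m, 1] := by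
    intro m hm
    have p2 : ∀ i, (0 : ℝ) < ![1, m, 1] i := fun i => by fin_cases i <;> simp [hm]
    obtain ⟨l₂, hl₂, e2⟩ := h _ p2
    have hc0 := hc 0
    have hc1 := hc 1
    have hc2 := hc 2
    have hY' : 0 < Y - 1 := by linarith
    refine ⟨l₁ * l₂ * l₃ * (c 0 * c 1 * c 2) * (Y - 1), by positivity, ?_, ?_, hD _ p2⟩
    · unfold tripleProd
      simp only [e1, e2, e3]
      simp only [Matrix.cons_val_zero, Matrix.cons_val_one, Matrix.cons_val, Real.one_rpow]
      ring
    · simp [tripleProd]; ring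
  have hup : ∀ m : ℝ, 1 < m → 2 * X ≤ m ^ α * (1 + Y) := by
    intro m hm
    obtain ⟨C, hC, h1, h2, h3⟩ := key m (by linarith)
    have := hF.tripleProd_nonpos (hD _ p1) h3 (hD _ p3) (by rw [h2]; linarith)
    rw [h1] at this
    nlinarith
  have hdown : ∀ m : ℝ, 0 < m → m < 1 → m ^ α * (1 + Y) ≤ 2 * X := by
    intro m hm0 hm
    obtain ⟨C, hC, h1, h2, h3⟩ := key m hm0
    have := hF.tripleProd_nonneg (hD _ p1) h3 (hD _ p3) (by rw [h2]; linarith)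
    rw [h1] at this
    nlinarith
  have hlim : Tendsto (fun m : ℝ => m ^ α * (1 + Y)) (𝓝 1) (𝓝 (1 + Y)) := by
    have : ContinuousAt (fun m : ℝ => m ^ α * (1 + Y)) 1 :=
      (Real.continuousAt_rpow_const 1 α (Or.inl one_ne_zero)).mul continuousAt_const
    simpa [ContinuousAt] using this
  have hα1 : α = 1 := by
    refine rpow_mean_eq hα (le_antisymm ?_ ?_)
    · refine le_of_tendsto (hlim.mono_left (nhdsWithin_le_nhds (s := Set.Iio 1))) ?_
      filter_upwards [self_mem_nhdsWithin,
        nhdsWithin_le_nhds (lt_mem_nhds (zero_lt_one (α := ℝ)))] with m hm hm0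
      exact hdown m hm0 hm
    · refine ge_of_tendsto (hlim.mono_left (nhdsWithin_le_nhds (s := Set.Ioi 1))) ?_
      filter_upwards [self_mem_nhdsWithin] with m hm
      exact hup m hm
  refine ⟨c, hc, fun z hz => ?_⟩
  obtain ⟨l, hl, hz'⟩ := h z hz
  exact ⟨l, hl, fun i => by rw [hz', hα1, Real.rpow_one]⟩

/-- In rank three, a weak map is the identity in homogeneous coordinates. -/
theorem eq_smul_of_fin_three (hF : IsWeakMap F) {z : Fin 3 → ℝ} (hz : SumPos z) :
    ∃ c : ℝ, 0 < c ∧ F z = c • z := by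
  obtain ⟨c, hc, hT⟩ := hF.exists_diagonal
  -- Dividing out the diagonal leaves a map that fixes the open triangle projectively.
  have hG : ∀ z : Fin 3 → ℝ, SumPos z → ∃ l : ℝ, 0 < l ∧ (fun i => (c i)⁻¹ * F z i) = l • z := by
    intro z hz
    refine eq_smul_of_eq_smul_on_open (F := fun z i => (c i)⁻¹ * F z i) (by simp) ?_ ?_ ?_
      (U := {z | ∀ i, 0 < z i}) ?_ ⟨fun _ => 1, fun _ => one_pos⟩ ?_ ?_ hz
    · intro z hz h
      refine hF.ne_zero z hz (funext fun i => ?_)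
      have := congrFun h i
      simpa [(hc i).ne'] using this
    · intro M hM hdet
      have h1 := hF.det_nonneg M hM hdet
      have h2 := Matrix.det_mul_row (fun i => (c i)⁻¹) (Matrix.of fun i => F (M i))
      have h3 : 0 < ∏ i, (c i)⁻¹ := Finset.prod_pos fun i _ => inv_pos.mpr (hc i)
      refine le_of_le_of_eq (mul_nonneg h3.le h1) ?_
      rw [← h2]
      rfl
    · intro z hz l hl
      obtain ⟨k, hk⟩ : ∃ k, 0 < z k := by
        by_contra! h
        exact absurd hz (not_lt.mpr (Finset.sum_nonpos fun i _ => h i))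
      have h1 := hF.coord_nonneg hz hk
      have h2 := congrFun hl k
      simp only [Pi.smul_apply, smul_eq_mul] at h2
      have h3 : 0 ≤ l * z k := by rw [← h2]; exact mul_nonneg (inv_pos.mpr (hc k)).le h1
      exact nonneg_of_mul_nonneg_left h3 hk
    · rw [Set.ofPred_forall]
      exact isOpen_iInter_of_finite fun i => isOpen_lt continuous_const (by fun_prop)
    · exact fun t ht => Finset.sum_pos (fun i _ => ht i) Finset.univ_nonempty
    · intro t ht
      obtain ⟨l, hl, h⟩ := hT t ht
      refine ⟨l, hl, funext fun i => ?_⟩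
      have := (hc i).ne'
      simp only [h i, Pi.smul_apply, smul_eq_mul]
      field_simp
  have hFz : ∀ z : Fin 3 → ℝ, SumPos z → ∃ l : ℝ, 0 < l ∧ ∀ i, F z i = l * (c i * z i) := by
    intro z hz
    obtain ⟨l, hl, h⟩ := hG z hz
    refine ⟨l, hl, fun i => ?_⟩
    have h1 := congrFun h i
    simp only [Pi.smul_apply, smul_eq_mul] at h1
    rw [inv_mul_eq_iff_eq_mul₀ (hc i).ne'] at h1
    rw [h1]; ring
  have hle : ∀ i j, i ≠ j → c j ≤ c i := by
    intro i j hij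
    by_contra! hlt
    -- This `M` gives a vector of sum one whose weighted sum `M c i + (1 - M) c j` equals `-(c j - c
    -- i) < 0`: unequal weights would carry a finite point beyond infinity.
    set M := c j / (c j - c i) + 1 with hM
    set v : Fin 3 → ℝ := M • Pi.single i 1 + (1 - M) • Pi.single j 1 with hv
    have hvs : SumPos v := by
      simp [SumPos, hv, Finset.sum_add_distrib, ← Finset.mul_sum]
    obtain ⟨l, hl, h⟩ := hFz v hvs
    have h1 := hF.sum_nonneg v hvs
    simp only [h] at h1
    rw [← Finset.mul_sum] at h1
    have h2 : ∑ k, c k * v k = M * c i + (1 - M) * c j := by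
      simp [hv, mul_add, Finset.sum_add_distrib, Pi.single_apply]
      ring
    rw [h2] at h1
    have h3 : M * c i + (1 - M) * c j < 0 := by
      have h4 : (c j - c i) * (c j / (c j - c i)) = c j := by
        field_simp [(sub_pos.mpr hlt).ne']
      rw [hM]
      nlinarith
    nlinarith
  have hall : ∀ i, c i = c 0 := by
    intro i
    by_cases hi : i = 0
    · rw [hi]
    · exact le_antisymm (hle _ _ (Ne.symm hi)) (hle _ _ hi)
  obtain ⟨l, hl, h⟩ := hFz z hz
  refine ⟨l * c 0, mul_pos hl (hc 0), funext fun i => ?_⟩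
  rw [h i, hall i, Pi.smul_apply, smul_eq_mul]; ring

end IsWeakMap

/-! ### Reduction of higher rank to rank three -/

namespace IsWeakMap

section Reduction

variable {I : Type*}

/-- The splitting of an index set into the range of an injection and its complement. -/
noncomputable def splitEquiv {τ : Fin 3 → I} (hτ : Function.Injective τ) :
    Fin 3 ⊕ ↑(Set.range τ)ᶜ ≃ I :=
  haveI := Classical.decPred (· ∈ Set.range τ)
  ((Equiv.ofInjective τ hτ).sumCongr (Equiv.refl _)).trans (Equiv.Set.sumCompl (Set.range τ))

@[simp] theorem splitEquiv_inl {τ : Fin 3 → I} (hτ : Function.Injective τ) (m : Fin 3) :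
    splitEquiv hτ (Sum.inl m) = τ m := by
  simp [splitEquiv]

@[simp] theorem splitEquiv_inr {τ : Fin 3 → I} (hτ : Function.Injective τ)
    (k : ↑(Set.range τ)ᶜ) : splitEquiv hτ (Sum.inr k) = k := by
  simp [splitEquiv]

theorem splitEquiv_symm_apply {τ : Fin 3 → I} (hτ : Function.Injective τ) (m : Fin 3) :
    (splitEquiv hτ).symm (τ m) = Sum.inl m := by
  rw [Equiv.symm_apply_eq, splitEquiv_inl]

theorem splitEquiv_symm_coe {τ : Fin 3 → I} (hτ : Function.Injective τ)
    (k : ↑(Set.range τ)ᶜ) : (splitEquiv hτ).symm k = Sum.inr k := by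
  rw [Equiv.symm_apply_eq, splitEquiv_inr]

variable [DecidableEq I]

/-- A section of the projection to three coordinates that fixes the coordinate vectors and is
proportional to `z` in the other coordinates elsewhere. -/
noncomputable def liftCoords {τ : Fin 3 → I} (hτ : Function.Injective τ) (z : I → ℝ)
    (u : Fin 3 → ℝ) : I → ℝ :=
  open scoped Classical in
  if h : ∃ m, u = Pi.single m 1 then Pi.single (τ h.choose) 1 else
    fun k => Sum.elim u (fun k : ↑(Set.range τ)ᶜ => (∑ m, u m) / (∑ m, z (τ m)) * z k)
      ((splitEquiv hτ).symm k)

theorem liftCoords_single {τ : Fin 3 → I} (hτ : Function.Injective τ) (z : I → ℝ) (m : Fin 3) :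
    liftCoords hτ z (Pi.single m 1) = Pi.single (τ m) 1 := by
  have h : ∃ m', (Pi.single m 1 : Fin 3 → ℝ) = Pi.single m' 1 := ⟨m, rfl⟩
  rw [liftCoords, dif_pos h]
  have h2 : m = h.choose := by
    have h1 := congrFun h.choose_spec m
    by_contra hne
    rw [Pi.single_eq_same, Pi.single_eq_of_ne hne] at h1
    exact one_ne_zero h1
  rw [← h2]

theorem liftCoords_apply {τ : Fin 3 → I} (hτ : Function.Injective τ) (z : I → ℝ) (u : Fin 3 → ℝ)
    (m : Fin 3) : liftCoords hτ z u (τ m) = u m := by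
  by_cases h : ∃ m, u = Pi.single m 1
  · obtain ⟨m', rfl⟩ := h
    rw [liftCoords_single]
    simp [Pi.single_apply, hτ.eq_iff]
  · rw [liftCoords, dif_neg h]
    simp [splitEquiv_symm_apply]

theorem liftCoords_compl {τ : Fin 3 → I} (hτ : Function.Injective τ) (z : I → ℝ) {u : Fin 3 → ℝ}
    (h : ¬∃ m, u = Pi.single m 1) (k : ↑(Set.range τ)ᶜ) :
    liftCoords hτ z u k = (∑ m, u m) / (∑ m, z (τ m)) * z k := by
  rw [liftCoords, dif_neg h]
  simp [splitEquiv_symm_coe]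

variable [Fintype I]

theorem sum_split {τ : Fin 3 → I} (hτ : Function.Injective τ) (f : I → ℝ) :
    ∑ i, f i = ∑ m, f (τ m) + ∑ k : ↑(Set.range τ)ᶜ, f k := by
  rw [← (splitEquiv hτ).sum_comp, Fintype.sum_sum_type]
  simp

/-- Three prescribed rows, completed by rows of the identity matrix. -/
noncomputable def completedRows {τ : Fin 3 → I} (hτ : Function.Injective τ) (r : Fin 3 → I → ℝ) :
    I → I → ℝ :=
  fun k => Sum.elim r (fun k : ↑(Set.range τ)ᶜ => Pi.single (k : I) 1) ((splitEquiv hτ).symm k)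

/-- After reordering, the matrix is block triangular with an identity block. -/
theorem det_completedRows {τ : Fin 3 → I} (hτ : Function.Injective τ) (r : Fin 3 → I → ℝ) :
    (Matrix.of (completedRows hτ r)).det = (Matrix.of fun a b => r a (τ b)).det := by
  rw [← Matrix.det_submatrix_equiv_self (splitEquiv hτ)]
  have : (Matrix.of (completedRows hτ r)).submatrix (splitEquiv hτ) (splitEquiv hτ) =
      Matrix.fromBlocks (Matrix.of fun a b => r a (τ b)) 
        (Matrix.of fun a (k : ↑(Set.range τ)ᶜ) => r a k) 0 1 := by
    ext i j
    rcases i with a | k <;> rcases j with b | k'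
    · simp [completedRows, splitEquiv_symm_apply]
    · simp [completedRows, splitEquiv_symm_apply]
    · have : τ b ≠ k := fun h => k.2 ⟨b, h⟩
      simp [completedRows, splitEquiv_symm_coe, this]
    · simp [completedRows, splitEquiv_symm_coe, Matrix.one_apply, Pi.single_apply,
        Subtype.ext_iff, eq_comm]
  rw [this, Matrix.det_fromBlocks_zero₂₁, Matrix.det_one, mul_one]

variable {F : (I → ℝ) → I → ℝ}

theorem map_completedRows (hF : IsWeakMap F) {τ : Fin 3 → I} (hτ : Function.Injective τ)
    (r : Fin 3 → I → ℝ) :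
    (fun k => F (completedRows hτ r k)) = completedRows hτ fun a => F (r a) := by
  funext k
  obtain ⟨i, rfl⟩ := (splitEquiv hτ).surjective k
  rcases i with a | k
  · simp only [completedRows, Equiv.symm_apply_apply, Sum.elim_inl]
  · simp only [completedRows, Equiv.symm_apply_apply, Sum.elim_inr, hF.fix]

/-- Contraction of a weak map to three coordinates. -/
theorem contract (hF : IsWeakMap F) {τ : Fin 3 → I} (hτ : Function.Injective τ) {z : I → ℝ}
    (hz : 0 < ∑ i, z i) (hneg : ∀ k ∉ Set.range τ, z k < 0) :
    IsWeakMap fun u m => F (liftCoords hτ z u) (τ m) := by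
  have : Nontrivial I := ⟨⟨τ 0, τ 1, fun h => absurd (hτ h) (by decide)⟩⟩
  have hs : 0 < ∑ m, z (τ m) := by
    rw [sum_split hτ] at hz
    have : ∑ k : ↑(Set.range τ)ᶜ, z k ≤ 0 := Finset.sum_nonpos fun k _ => (hneg k k.2).le
    linarith
  have hsum : ∀ u : Fin 3 → ℝ, 0 < ∑ m, u m → 0 < ∑ i, liftCoords hτ z u i := by
    intro u hu
    by_cases h : ∃ m, u = Pi.single m 1
    · obtain ⟨m, rfl⟩ := h
      simp [liftCoords_single]
    · rw [sum_split hτ]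
      simp only [liftCoords_apply, liftCoords_compl hτ z h, ← Finset.mul_sum]
      rw [sum_split hτ] at hz
      have : ∑ m, u m + (∑ m, u m) / (∑ m, z (τ m)) * ∑ k : ↑(Set.range τ)ᶜ, z k =
          (∑ m, u m) / (∑ m, z (τ m)) *
            (∑ m, z (τ m) + ∑ k : ↑(Set.range τ)ᶜ, z k) := by
        field_simp
      rw [this]
      positivity
  -- Negative discarded coordinates have nonpositive images, so discarding them does not lower the
  -- sum, and the three remaining entries cannot all vanish.
  have hcompl : ∀ u : Fin 3 → ℝ, 0 < ∑ m, u m → ∀ k : ↑(Set.range τ)ᶜ,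
      F (liftCoords hτ z u) k ≤ 0 := by
    intro u hu k
    by_cases h : ∃ m, u = Pi.single m 1
    · obtain ⟨m, rfl⟩ := h
      have : (k : I) ≠ τ m := fun h => k.2 ⟨m, h.symm⟩
      rw [liftCoords_single, hF.fix]
      simp [this]
    · refine hF.coord_nonpos (hsum u hu) ?_
      rw [liftCoords_compl hτ z h]
      exact mul_neg_of_pos_of_neg (div_pos hu hs) (hneg k k.2)
  refine ⟨fun u hu h0 => ?_, fun u hu => ?_, fun m => ?_, fun M hM hdet => ?_⟩
  · have h1 := hF.sum_nonneg _ (hsum u hu)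
    have h2 : ∀ m, F (liftCoords hτ z u) (τ m) = 0 := fun m => congrFun h0 m
    rw [sum_split hτ] at h1
    simp only [h2, Finset.sum_const_zero, zero_add] at h1
    have h3 := (Finset.sum_eq_zero_iff_of_nonpos fun k _ => hcompl u hu k).mp
      (le_antisymm (Finset.sum_nonpos fun k _ => hcompl u hu k) h1)
    refine hF.ne_zero _ (hsum u hu) (funext fun i => ?_)
    obtain ⟨i, rfl⟩ := (splitEquiv hτ).surjective i
    rcases i with a | k
    · rw [splitEquiv_inl]; exact h2 a
    · rw [splitEquiv_inr]; exact h3 k (Finset.mem_univ k)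
  · have h1 := hF.sum_nonneg _ (hsum u hu)
    rw [sum_split hτ] at h1
    have h2 := Finset.sum_nonpos fun k (_ : k ∈ Finset.univ) => hcompl u hu k
    linarith
  -- Coordinate vectors are lifted by the special case of `liftCoords`; the proportional formula
  -- would give them negative entries outside the range of `τ`.
  · funext m'
    simp only [liftCoords_single, hF.fix]
    simp [Pi.single_apply, hτ.eq_iff]
  · have h1 := hF.det_nonneg (completedRows hτ fun a => liftCoords hτ z (M a)) ?_ ?_
    · rw [hF.map_completedRows, det_completedRows] at h1
      exact h1
    · intro k
      obtain ⟨i, rfl⟩ := (splitEquiv hτ).surjective k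
      rcases i with a | k
      · simpa [completedRows, splitEquiv_symm_apply] using hsum (M a) (hM a)
      · simp [completedRows, splitEquiv_symm_coe]
    · rw [det_completedRows]
      simpa only [liftCoords_apply] using hdet

/-- The lift is proportional to `z` outside the range of `τ`, so `z` is the lift of its own
projection unless that projection is a coordinate vector. -/
theorem eq_mul_of_neg (hF : IsWeakMap F) {τ : Fin 3 → I} (hτ : Function.Injective τ) {z : I → ℝ}
    (hz : 0 < ∑ i, z i) (hneg : ∀ k ∉ Set.range τ, z k < 0)
    (hzτ : ¬∃ m, (fun m => z (τ m)) = (Pi.single m 1 : Fin 3 → ℝ)) :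
    ∃ c : ℝ, 0 < c ∧ ∀ m, F z (τ m) = c * z (τ m) := by
  have hs : 0 < ∑ m, z (τ m) := by
    rw [sum_split hτ] at hz
    have : ∑ k : ↑(Set.range τ)ᶜ, z k ≤ 0 := Finset.sum_nonpos fun k _ => (hneg k k.2).le
    linarith
  obtain ⟨c, hc, h⟩ := (hF.contract hτ hz hneg).eq_smul_of_fin_three (z := fun m => z (τ m)) hs
  have hlift : liftCoords hτ z (fun m => z (τ m)) = z := by
    funext i
    obtain ⟨i, rfl⟩ := (splitEquiv hτ).surjective i
    rcases i with a | k
    · rw [splitEquiv_inl, liftCoords_apply]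
    · rw [splitEquiv_inr, liftCoords_compl hτ z hzτ, div_self hs.ne', one_mul]
  rw [hlift] at h
  exact ⟨c, hc, fun m => congrFun h m⟩

/-- In rank at least three, a weak map is the identity in homogeneous coordinates. -/
theorem eq_smul (hF : IsWeakMap F) (hI : 3 ≤ Fintype.card I) {z : I → ℝ} (hz : 0 < ∑ i, z i) :
    ∃ c : ℝ, 0 < c ∧ F z = c • z := by
  obtain ⟨i₀⟩ : Nonempty I := Fintype.card_pos_iff.mp (by omega)
  refine eq_smul_of_eq_smul_on_open hI hF.ne_zero hF.det_nonneg ?_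
    (U := {z | 0 < ∑ i, z i} ∩ {z | ∀ k, k ≠ i₀ → z k < 0}) ?_ ?_ (fun t ht => ht.1) ?_ hz
  · intro z hz l hl
    obtain ⟨k, hk⟩ : ∃ k, 0 < z k := by
      by_contra! h
      exact absurd hz (not_lt.mpr (Finset.sum_nonpos fun i _ => h i))
    have h1 := hF.coord_nonneg hz hk
    rw [hl] at h1
    exact nonneg_of_mul_nonneg_left h1 hk
  · refine (isOpen_lt continuous_const (by fun_prop)).inter ?_
    simp only [Set.ofPred_forall]
    exact isOpen_iInter_of_finite fun k => isOpen_iInter_of_finite fun _ =>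
      isOpen_lt (by fun_prop) continuous_const
  -- The sum is `card I - (card I - 1) = 1`.
  · refine ⟨fun k => if k = i₀ then (Fintype.card I : ℝ) else -1, ?_, fun k hk => by simp [hk]⟩
    change (0:ℝ) < ∑ k, if k = i₀ then (Fintype.card I : ℝ) else -1
    rw [Finset.sum_ite]
    have : (Finset.univ.filter fun k => ¬k = i₀).card = Fintype.card I - 1 := by
      rw [Finset.filter_not, Finset.card_sdiff_of_subset (Finset.filter_subset _ _)]
      simp [Finset.filter_eq']
    simp only [Finset.sum_const, this, nsmul_eq_mul, Finset.filter_eq', Finset.mem_univ,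
      if_true, Finset.card_singleton, Nat.cast_one, one_mul]
    rw [Nat.cast_sub (by omega)]
    push_cast
    linarith
  · rintro z ⟨hz, hneg⟩
    have hz : 0 < ∑ i, z i := hz
    have hneg : ∀ k, k ≠ i₀ → z k < 0 := hneg
    have hz0 : 0 < z i₀ := by
      by_contra! h
      refine absurd hz (not_lt.mpr (Finset.sum_nonpos fun i _ => ?_))
      by_cases hi : i = i₀
      · rwa [hi]
      · exact (hneg i hi).le
    -- Each triple containing `i₀` and `i` gives a common factor for these two coordinates. The
    -- shared coordinate `z i₀ ≠ 0` makes the factors for different `i` agree.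
    have key : ∀ i, i ≠ i₀ → ∃ c : ℝ, 0 < c ∧ F z i₀ = c * z i₀ ∧ F z i = c * z i := by
      intro i hi
      obtain ⟨j, hj⟩ : ∃ j, j ∉ ({i₀, i} : Finset I) := by
        by_contra! h
        have h1 := Finset.card_le_card (fun k _ => h k : Finset.univ ⊆ ({i₀, i} : Finset I))
        have h2 : ({i₀, i} : Finset I).card ≤ 2 := Finset.card_le_two
        rw [Finset.card_univ] at h1
        omega
      simp only [Finset.mem_insert, Finset.mem_singleton, not_or] at hj
      have hτ : Function.Injective ![i₀, i, j] := by
        intro a b hab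
        fin_cases a <;> fin_cases b <;> simp_all
      have hzτ : ¬∃ m, (fun m => z (![i₀, i, j] m)) = (Pi.single m 1 : Fin 3 → ℝ) := by
        rintro ⟨m, hm⟩
        have h1 := congrFun hm 1
        simp only [Matrix.cons_val_one, Matrix.cons_val_zero] at h1
        have h2 := hneg i hi
        rw [h1, Pi.single_apply] at h2
        split_ifs at h2 <;> linarith
      obtain ⟨c, hc, h⟩ := hF.eq_mul_of_neg hτ hz
        (fun k hk => hneg k fun h => hk ⟨0, by simp [h]⟩) hzτ
      exact ⟨c, hc, by simpa using h 0, by simpa using h 1⟩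
    obtain ⟨i, hi⟩ : ∃ i, i ≠ i₀ := by
      have : Nontrivial I := Fintype.one_lt_card_iff_nontrivial.mp (by omega)
      exact exists_ne i₀
    obtain ⟨c, hc, h0, _⟩ := key i hi
    refine ⟨c, hc, funext fun k => ?_⟩
    by_cases hk : k = i₀
    · rw [hk]; exact h0
    · obtain ⟨c', _, h0', h1⟩ := key k hk
      have : c' = c := mul_right_cancel₀ hz0.ne' (h0'.symm.trans h0)
      rw [h1, this]; rfl

end Reduction

end IsWeakMap

/-! ### Generic extensions approximating given points -/

namespace PointConfig

/-- Every new point avoids all proper affine subspaces spanned by other points. -/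
def StronglyGeneric {d : ℕ} {X Y : Type u} (ι : X ↪ Y) (R : PointConfig d Y) : Prop :=
  ∀ y : Y, y ∉ Set.range ι → ∀ S : Set Y, y ∉ S →
    affineSpan ℝ (R '' S) ≠ ⊤ → R y ∉ affineSpan ℝ (R '' S)

theorem IsHyperplane.ne_top {d : ℕ} {H : AffineSubspace ℝ (Fin d → ℝ)} (h : IsHyperplane H) :
    H ≠ ⊤ := by
  rintro rfl
  have := h.2
  rw [AffineSubspace.direction_top, finrank_top, Module.finrank_fin_fun] at this
  omega

theorem StronglyGeneric.genericExtends {d : ℕ} {X Y : Type u} {ι : X ↪ Y} {R : PointConfig d Y}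
    {P : PointConfig d X} (h : StronglyGeneric ι R) (hP : Extends ι R P) : GenericExtends ι R P :=
  ⟨hP, fun y hy S hyS hS => h y hy S hyS hS.ne_top⟩

/-- Proper affine subspaces are null sets, and the complement of a null set is dense. -/
theorem exists_near_notMem_affineSubspaces {d : ℕ} {𝒮 : Set (AffineSubspace ℝ (Fin d → ℝ))}
    (h𝒮 : 𝒮.Finite) (hne : ∀ s ∈ 𝒮, s ≠ ⊤) (r : Fin d → ℝ) {δ : ℝ} (hδ : 0 < δ) :
    ∃ r', dist r' r < δ ∧ ∀ s ∈ 𝒮, r' ∉ s := by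
  have hae : ∀ᵐ x : Fin d → ℝ, ∀ s ∈ 𝒮, x ∉ s := by
    rw [MeasureTheory.ae_ball_iff h𝒮.countable]
    intro s hs
    have := MeasureTheory.Measure.addHaar_affineSubspace MeasureTheory.volume s (hne s hs)
    exact MeasureTheory.measure_eq_zero_iff_ae_notMem.mp this
  obtain ⟨r', hr', h⟩ := (MeasureTheory.Measure.dense_of_ae hae).exists_mem_open
    Metric.isOpen_ball ⟨r, Metric.mem_ball_self hδ⟩
  exact ⟨r', h, hr'⟩

theorem mem_affineSpan_insert_exchange {d : ℕ} {A : Set (Fin d → ℝ)} {p q : Fin d → ℝ}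
    (h : p ∈ affineSpan ℝ (insert q A)) (hp : p ∉ affineSpan ℝ A) :
    q ∈ affineSpan ℝ (insert p A) := by
  rcases A.eq_empty_or_nonempty with rfl | ⟨a, ha⟩
  · rw [insert_empty_eq, AffineSubspace.mem_affineSpan_singleton] at h ⊢
    exact h.symm
  · have ha' := subset_affineSpan ℝ A ha
    rw [← affineSpan_insert_affineSpan, AffineSubspace.mem_affineSpan_insert_iff ha'] at h
    obtain ⟨t, p₀, hp₀, hpt⟩ := h
    have ht : t ≠ 0 := by
      rintro rfl
      rw [zero_smul, zero_vadd] at hpt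
      exact hp (hpt ▸ hp₀)
    rw [← affineSpan_insert_affineSpan, AffineSubspace.mem_affineSpan_insert_iff ha']
    refine ⟨t⁻¹, AffineMap.lineMap a p₀ (-t⁻¹), AffineMap.lineMap_mem _ ha' hp₀, ?_⟩
    rw [hpt]
    ext i
    simp [AffineMap.lineMap_apply]
    field_simp
    ring

/-- The added point could spoil the position of an earlier new point `y` only if `R y` entered a
flat spanned with the help of `r`. Exchange then puts `r` in a proper flat spanned by old points.
Removing `r` may drop the dimension of the flat, so hyperplanes alone would not suffice for this
induction. -/
theorem StronglyGeneric.insert {d : ℕ} {X Y : Type u} {ι : X ↪ Y} {R : PointConfig d Y}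
    (h : StronglyGeneric ι R) {r : Fin d → ℝ}
    (hr : ∀ S : Set Y, affineSpan ℝ (R '' S) ≠ ⊤ → r ∉ affineSpan ℝ (R '' S)) :
    StronglyGeneric (ι.trans Function.Embedding.some) (fun o : Option Y => o.elim r R) := by
  have himg : ∀ S : Set (Option Y), none ∉ S →
      (fun o : Option Y => o.elim r R) '' S = R '' (some ⁻¹' S) := by
    intro S hS
    ext x
    constructor
    · rintro ⟨o, ho, rfl⟩
      cases o with
      | none => exact absurd ho hS
      | some y => exact ⟨y, ho, rfl⟩
    · rintro ⟨y, hy, rfl⟩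
      exact ⟨some y, hy, rfl⟩
  have himg' : ∀ S : Set (Option Y), none ∈ S →
      (fun o : Option Y => o.elim r R) '' S = Insert.insert r (R '' (some ⁻¹' S)) := by
    intro S hS
    ext x
    constructor
    · rintro ⟨o, ho, rfl⟩
      cases o with
      | none => exact Or.inl rfl
      | some y => exact Or.inr ⟨y, ho, rfl⟩
    · rintro (rfl | ⟨y, hy, rfl⟩)
      · exact ⟨none, hS, rfl⟩
      · exact ⟨some y, hy, rfl⟩
  intro o ho S hoS hS
  cases o with
  | none =>
    rw [himg S hoS] at hS ⊢
    exact hr _ hS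
  | some y =>
    have hy : y ∉ Set.range ι := by
      rintro ⟨x, rfl⟩
      exact ho ⟨x, rfl⟩
    by_cases hn : none ∈ S
    · rw [himg' S hn] at hS ⊢
      intro hmem
      have hsub : affineSpan ℝ (R '' (some ⁻¹' S)) ≠ ⊤ := fun htop =>
        hS (top_le_iff.mp (htop ▸ affineSpan_mono ℝ (Set.subset_insert _ _)))
      have hex := mem_affineSpan_insert_exchange hmem (h y hy _ hoS hsub)
      change r ∈ affineSpan ℝ (Insert.insert (R y) (R '' (some ⁻¹' S))) at hex
      rw [← Set.image_insert_eq] at hex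
      refine hr _ (fun htop => hS (top_le_iff.mp ?_)) hex
      rw [← htop, affineSpan_le, Set.image_insert_eq]
      exact Set.insert_subset hmem
        ((Set.subset_insert _ _).trans (subset_affineSpan ℝ _))
    · rw [himg S hn] at hS ⊢
      exact h y hy _ hoS hS

/-- Finitely many target points can be approximated by the new points of a generic extension. -/
theorem exists_genericExtends_near {d : ℕ} {X : Type u} [Finite X] (P : PointConfig d X)
    {J : Type*} (r : J → Fin d → ℝ) {δ : ℝ} (hδ : 0 < δ) (s : Finset J) :
    ∃ (Y : Type u) (_ : Finite Y) (ι : X ↪ Y) (R : PointConfig d Y), GenericExtends ι R P ∧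
      ∀ j ∈ s, ∃ y, dist (R y) (r j) < δ := by
  classical
  suffices h : ∃ (Y : Type u) (_ : Finite Y) (ι : X ↪ Y) (R : PointConfig d Y),
      Extends ι R P ∧ StronglyGeneric ι R ∧ ∀ j ∈ s, ∃ y, dist (R y) (r j) < δ by
    obtain ⟨Y, hY, ι, R, h1, h2, h3⟩ := h
    exact ⟨Y, hY, ι, R, h2.genericExtends h1, h3⟩
  induction s using Finset.induction_on with
  | empty =>
    exact ⟨X, inferInstance, Function.Embedding.refl X, P, fun _ => rfl,
      fun y hy => absurd ⟨y, rfl⟩ hy, by simp⟩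
  | insert j s _ ih =>
    obtain ⟨Y, hY, ι, R, h1, h2, h3⟩ := ih
    obtain ⟨r', hr', hav⟩ := exists_near_notMem_affineSubspaces
      (𝒮 := {H | H ≠ ⊤} ∩ Set.range fun S : Set Y => affineSpan ℝ (R '' S))
      ((Set.finite_range _).inter_of_right _) (fun s hs => hs.1) (r j) hδ
    refine ⟨Option Y, inferInstance, _, _, ?_, h2.insert (r := r')
      fun S hS => hav _ ⟨hS, S, rfl⟩, ?_⟩
    · exact fun i => h1 i
    · intro k hk
      rcases Finset.mem_insert.mp hk with rfl | hk
      · exact ⟨none, hr'⟩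
      · obtain ⟨y, hy⟩ := h3 k hk
        exact ⟨some y, hy⟩

end PointConfig

/-! ### Homogeneous and barycentric coordinates -/

namespace PointConfig

variable {d : ℕ}

/-- The vector of homogeneous coordinates of a point. -/
def homCoord (p : Fin d → ℝ) : Fin (d + 1) → ℝ := Fin.snoc p 1

theorem homCoord_last (p : Fin d → ℝ) : homCoord p (Fin.last d) = 1 := by simp [homCoord]

theorem homCoord_castSucc (p : Fin d → ℝ) (i : Fin d) : homCoord p i.castSucc = p i := by
  simp [homCoord]

theorem homCoord_injective : Function.Injective (homCoord : (Fin d → ℝ) → _) := by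
  intro p q h
  funext i
  rw [← homCoord_castSucc p, h, homCoord_castSucc]

theorem continuous_homCoord : Continuous (homCoord : (Fin d → ℝ) → _) := by
  refine continuous_pi fun i => ?_
  refine Fin.lastCases ?_ (fun i => ?_) i
  · simp only [homCoord_last]; exact continuous_const
  · simp only [homCoord_castSucc]; exact continuous_apply i

theorem homMatrix_eq (p : Fin (d + 1) → Fin d → ℝ) :
    homMatrix p = (Matrix.of fun j => homCoord (p j)).transpose := by
  ext i j
  rfl

theorem det_homMatrix (p : Fin (d + 1) → Fin d → ℝ) :
    (homMatrix p).det = (Matrix.of fun j => homCoord (p j)).det := by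
  rw [homMatrix_eq, Matrix.det_transpose]

theorem continuous_det_homMatrix :
    Continuous fun p : Fin (d + 1) → Fin d → ℝ => (homMatrix p).det := by
  simp only [det_homMatrix]
  refine Continuous.matrix_det (continuous_matrix fun i j => ?_)
  exact (continuous_apply j).comp (continuous_homCoord.comp (continuous_apply i))

theorem span_homCoord_eq_top {X : Type u} {P : PointConfig d X} (hP : P.FullDimensional) :
    Submodule.span ℝ (Set.range fun x => homCoord (P x)) = ⊤ := by
  set W := Submodule.span ℝ (Set.range fun x => homCoord (P x))
  let h : (Fin d → ℝ) →ᵃ[ℝ] (Fin (d + 1) → ℝ) :=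
    { toFun := homCoord
      linear :=
        { toFun := fun v => Fin.snoc v 0
          map_add' := fun v w => by
            funext i
            refine Fin.lastCases ?_ (fun i => ?_) i <;> simp
          map_smul' := fun c v => by
            funext i
            refine Fin.lastCases ?_ (fun i => ?_) i <;> simp }
      map_vadd' := fun p v => by
        funext i
        refine Fin.lastCases ?_ (fun i => ?_) i <;> simp [homCoord] }
  have hmem : ∀ p : Fin d → ℝ, homCoord p ∈ W := by
    intro p
    have hle : affineSpan ℝ (Set.range P) ≤ W.toAffineSubspace.comap h := by
      rw [affineSpan_le]
      rintro _ ⟨x, rfl⟩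
      exact Submodule.subset_span ⟨x, rfl⟩
    have hp : p ∈ affineSpan ℝ (Set.range P) := by
      rw [show affineSpan ℝ (Set.range P) = ⊤ from hP]
      exact AffineSubspace.mem_top ℝ _ p
    exact hle hp
  rw [eq_top_iff, ← (Pi.basisFun ℝ (Fin (d + 1))).span_eq, Submodule.span_le]
  rintro _ ⟨i, rfl⟩
  have h0 := hmem 0
  refine Fin.lastCases ?_ (fun i => ?_) i
  · have e : (Pi.basisFun ℝ (Fin (d + 1))) (Fin.last d) = homCoord 0 := by
      funext j
      refine Fin.lastCases ?_ (fun j => ?_) j <;> simp [homCoord]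
    rw [e]
    exact h0
  · have e : (Pi.basisFun ℝ (Fin (d + 1))) i.castSucc = homCoord (Pi.single i 1) - homCoord 0 := by
      funext j
      refine Fin.lastCases ?_ (fun j => ?_) j <;> simp [homCoord, Pi.single_apply]
    rw [e]
    exact W.sub_mem (hmem (Pi.single i 1)) h0

/-- A full-dimensional configuration contains the vertices of a simplex. -/
theorem exists_simplex {X : Type u} {P : PointConfig d X} (hP : P.FullDimensional) :
    ∃ b : Fin (d + 1) → X, (homMatrix fun i => P (b i)).det ≠ 0 := by
  obtain ⟨κ, a, -, hspan, hli⟩ := exists_linearIndependent' ℝ fun x => homCoord (P x)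
  rw [span_homCoord_eq_top hP] at hspan
  let B := Module.Basis.mk hli hspan.ge
  let e := (Pi.basisFun ℝ (Fin (d + 1))).indexEquiv B
  refine ⟨fun i => a (e i), ?_⟩
  rw [det_homMatrix]
  have h1 : LinearIndependent ℝ (Matrix.of fun i => homCoord (P (a (e i)))).row :=
    hli.comp e e.injective
  exact ((Matrix.isUnit_iff_isUnit_det _).mp
    (Matrix.linearIndependent_rows_iff_isUnit.mp h1)).ne_zero

/-- The matrix whose rows are the homogeneous coordinates of the vertices of a simplex. -/
def vertexMatrix (s : Fin (d + 1) → Fin d → ℝ) : Matrix (Fin (d + 1)) (Fin (d + 1)) ℝ :=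
  Matrix.of fun i => homCoord (s i)

/-- Barycentric coordinates with respect to a simplex. -/
noncomputable def bary (s : Fin (d + 1) → Fin d → ℝ) (p : Fin d → ℝ) : Fin (d + 1) → ℝ :=
  Matrix.vecMul (homCoord p) (vertexMatrix s)⁻¹

/-- The point with given homogeneous barycentric coordinates with respect to a simplex. -/
noncomputable def pointOf (s : Fin (d + 1) → Fin d → ℝ) (z : Fin (d + 1) → ℝ) : Fin d → ℝ :=
  Fin.init ((∑ i, z i)⁻¹ • Matrix.vecMul z (vertexMatrix s))

section Simplex

variable {s : Fin (d + 1) → Fin d → ℝ}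

theorem vecMul_vertexMatrix_last (z : Fin (d + 1) → ℝ) :
    Matrix.vecMul z (vertexMatrix s) (Fin.last d) = ∑ i, z i := by
  simp [Matrix.vecMul, dotProduct, vertexMatrix, homCoord_last]

theorem vecMul_bary (hs : (vertexMatrix s).det ≠ 0) (p : Fin d → ℝ) :
    Matrix.vecMul (bary s p) (vertexMatrix s) = homCoord p := by
  rw [bary, Matrix.vecMul_vecMul, Matrix.nonsing_inv_mul _ hs.isUnit, Matrix.vecMul_one]

theorem sum_bary (hs : (vertexMatrix s).det ≠ 0) (p : Fin d → ℝ) : ∑ i, bary s p i = 1 := by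
  rw [← vecMul_vertexMatrix_last (s := s), vecMul_bary hs, homCoord_last]

theorem bary_vertex (hs : (vertexMatrix s).det ≠ 0) (i : Fin (d + 1)) :
    bary s (s i) = Pi.single i 1 := by
  have h : homCoord (s i) = Matrix.vecMul (Pi.single i 1) (vertexMatrix s) := by
    funext j
    simp [vertexMatrix]
  rw [bary, h, Matrix.vecMul_vecMul, Matrix.mul_nonsing_inv _ hs.isUnit, Matrix.vecMul_one]

theorem homCoord_pointOf {z : Fin (d + 1) → ℝ} (hz : ∑ i, z i ≠ 0) :
    homCoord (pointOf s z) = (∑ i, z i)⁻¹ • Matrix.vecMul z (vertexMatrix s) := by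
  funext j
  refine Fin.lastCases ?_ (fun j => ?_) j
  · rw [homCoord_last, Pi.smul_apply, vecMul_vertexMatrix_last, smul_eq_mul, inv_mul_cancel₀ hz]
  · rw [homCoord_castSucc]; rfl

theorem det_of_vecMul (z : Fin (d + 1) → Fin (d + 1) → ℝ)
    (A : Matrix (Fin (d + 1)) (Fin (d + 1)) ℝ) :
    (Matrix.of fun i => Matrix.vecMul (z i) A).det = (Matrix.of z).det * A.det := by
  rw [← Matrix.det_mul]
  rfl

theorem det_homMatrix_eq_bary (hs : (vertexMatrix s).det ≠ 0) (p : Fin (d + 1) → Fin d → ℝ) :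
    (homMatrix p).det = (Matrix.of fun i => bary s (p i)).det * (vertexMatrix s).det := by
  rw [← det_of_vecMul, det_homMatrix]
  simp only [vecMul_bary hs]

end Simplex

/-! ### Compactness: a limit of realizations -/

/-- Limits of realizations: if every generic extension of `P` is realizable on top of `Q`, there is
a weakly orientation preserving map from all points to points at finite or infinite distance that
extends the correspondence between `P` and `Q`. -/
theorem exists_limit_realization {X : Type u} [Finite X] {P Q : PointConfig d X}
    {b : Fin (d + 1) → X} (hB : (vertexMatrix fun i => P (b i)).det ≠ 0)
    (hBC : 0 < (vertexMatrix fun i => P (b i)).det * (vertexMatrix fun i => Q (b i)).det)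
    (H : ∀ (Y : Type u) [Finite Y] (ι : X ↪ Y) (R : PointConfig d Y),
      GenericExtends ι R P → RealizableOnTop ι R.chirotope Q) :
    ∃ F : X ⊕ (Fin (d + 1) → ℝ) → Fin (d + 1) → ℝ,
      (∀ x, F (Sum.inl x) = bary (fun i => Q (b i)) (Q x)) ∧
      (∀ v, F (Sum.inr v) ≠ 0 ∧ 0 ≤ ∑ i, F (Sum.inr v) i) ∧
      ∀ t : Fin (d + 1) → X ⊕ (Fin (d + 1) → ℝ),
        (∀ i, 0 < ∑ j, Sum.elim (fun x => bary (fun i => P (b i)) (P x)) id (t i) j) →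
        0 < (Matrix.of fun i =>
          Sum.elim (fun x => bary (fun i => P (b i)) (P x)) id (t i)).det →
        0 ≤ (Matrix.of fun i => F (t i)).det := by
  classical
  set sP := fun i => P (b i)
  set sQ := fun i => Q (b i)
  have hC : (vertexMatrix sQ).det ≠ 0 := right_ne_zero_of_mul hBC.ne'
  set ζ : X ⊕ (Fin (d + 1) → ℝ) → Fin (d + 1) → ℝ := Sum.elim (fun x => bary sP (P x)) id with hζ
  set pos : X ⊕ (Fin (d + 1) → ℝ) → Fin d → ℝ := Sum.elim P (pointOf sP) with hpos
  have hposζ : ∀ j, 0 < ∑ i, ζ j i →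
      homCoord (pos j) = (∑ i, ζ j i)⁻¹ • Matrix.vecMul (ζ j) (vertexMatrix sP) := by
    rintro (x | v) hj
    · simp only [hζ, hpos, Sum.elim_inl]
      rw [sum_bary hB, inv_one, one_smul, vecMul_bary hB]
    · exact homCoord_pointOf hj.ne'
  let T := {t : Fin (d + 1) → X ⊕ (Fin (d + 1) → ℝ) //
    (∀ i, 0 < ∑ j, ζ (t i) j) ∧ 0 < (Matrix.of fun i => ζ (t i)).det}
  have hT : ∀ t : T, 0 < (vertexMatrix sP).det * (homMatrix fun i => pos (t.1 i)).det := by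
    rintro ⟨t, ht, htd⟩
    have h1 : (homMatrix fun i => pos (t i)).det = (∏ i, (∑ j, ζ (t i) j)⁻¹) *
        ((Matrix.of fun i => ζ (t i)).det * (vertexMatrix sP).det) := by
      rw [← det_of_vecMul, ← Matrix.det_mul_column, det_homMatrix]
      congr 1
      ext i j
      simp [hposζ (t i) (ht i)]
    have h2 : 0 < ∏ i, (∑ j, ζ (t i) j)⁻¹ := Finset.prod_pos fun i _ => inv_pos.mpr (ht i)
    rw [h1]
    have h3 := mul_pos (mul_pos h2 htd) (mul_self_pos.mpr hB)
    rw [show (vertexMatrix sP).det * ((∏ i, (∑ j, ζ (t i) j)⁻¹) *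
        ((Matrix.of fun i => ζ (t i)).det * (vertexMatrix sP).det)) =
      (∏ i, (∑ j, ζ (t i) j)⁻¹) * (Matrix.of fun i => ζ (t i)).det *
        ((vertexMatrix sP).det * (vertexMatrix sP).det) by ring]
    exact h3
  -- Labels of `X` keep their exact position over `Q`; every other vector is free on the compact
  -- part of the unit sphere with nonnegative sum, which includes directions at infinity.
  let K : X ⊕ (Fin (d + 1) → ℝ) → Set (Fin (d + 1) → ℝ) :=
    Sum.elim (fun x => {bary sQ (Q x)}) fun _ => Metric.sphere 0 1 ∩ {w | 0 ≤ ∑ i, w i}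
  have hK : ∀ j, IsCompact (K j) := by
    rintro (x | v)
    · exact isCompact_singleton
    · exact (isCompact_sphere _ _).inter_right (isClosed_le continuous_const (by fun_prop))
  have hne : (Set.univ.pi K ∩ ⋂ t : T,
      {F : X ⊕ (Fin (d + 1) → ℝ) → Fin (d + 1) → ℝ |
        0 ≤ (Matrix.of fun i => F (t.1 i)).det}).Nonempty := by
    refine (isCompact_univ_pi hK).inter_iInter_nonempty _ (fun t => ?_) fun u => ?_
    · refine isClosed_le continuous_const (Continuous.matrix_det (continuous_matrix fun i j => ?_))
      exact (continuous_apply j).comp (continuous_apply (t.1 i))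
    -- Finitely many determinant conditions involve finitely many points, and strict signs survive a
    -- perturbation by some `δ`. A generic extension within `δ` then has the prescribed
    -- orientations, and so does its realization over `Q`.
    · obtain ⟨δ, hδu, hδ⟩ : ∃ δ : ℝ, (∀ t ∈ u, ∀ p : Fin (d + 1) → Fin d → ℝ,
          (∀ i, dist (p i) (pos (t.1 i)) < δ) →
            0 < (vertexMatrix sP).det * (homMatrix p).det) ∧ 0 < δ := by
        have : ∀ t ∈ u, ∀ᶠ δ : ℝ in 𝓝[>] 0, ∀ p : Fin (d + 1) → Fin d → ℝ,
          (∀ i, dist (p i) (pos (t.1 i)) < δ) →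
            0 < (vertexMatrix sP).det * (homMatrix p).det := by
          intro t _
          have ho : IsOpen {p : Fin (d + 1) → Fin d → ℝ |
              0 < (vertexMatrix sP).det * (homMatrix p).det} :=
            isOpen_lt continuous_const (continuous_const.mul continuous_det_homMatrix)
          obtain ⟨ε, hε, hball⟩ := Metric.isOpen_iff.mp ho _ (hT t)
          filter_upwards [self_mem_nhdsWithin, nhdsWithin_le_nhds (gt_mem_nhds hε)]
            with δ hδ0 hδε p hp
          exact hball ((dist_pi_lt_iff hε).mpr fun i => (hp i).trans hδε)
        obtain ⟨δ, h1, h2⟩ := (((Filter.eventually_all_finset u).mpr this).and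
          self_mem_nhdsWithin).exists
        exact ⟨δ, h1, h2⟩
      let s : Finset (Fin (d + 1) → ℝ) := u.biUnion fun t => Finset.univ.biUnion fun i =>
        Sum.elim (fun _ => ∅) (fun v => {v}) (t.1 i)
      obtain ⟨Y, hY, ι, R, hR, hnear⟩ := exists_genericExtends_near P (pointOf sP) hδ s
      obtain ⟨R', hR', hχ⟩ := H Y ι R hR
      have hlab : ∀ j : X ⊕ (Fin (d + 1) → ℝ), ∃ y, (∀ x, j = Sum.inl x → y = ι x) ∧
          ∀ v, j = Sum.inr v → v ∈ s → dist (R y) (pointOf sP v) < δ := by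
        rintro (x | v)
        · exact ⟨ι x, fun x' h => by rw [Sum.inl.inj h], fun v h => by simp at h⟩
        · by_cases hv : v ∈ s
          · obtain ⟨y, hy⟩ := hnear v hv
            refine ⟨y, fun x h => by simp at h, fun v' h _ => ?_⟩
            rw [← Sum.inr.inj h]; exact hy
          -- Vectors that occur in no condition get an arbitrary label; only membership in `K` is
          -- required of them.
          · exact ⟨ι (b 0), fun x h => by simp at h, fun v' h hv' =>
              absurd (Sum.inr.inj h ▸ hv') hv⟩
      choose lab hlab₁ hlab₂ using hlab
      set w : X ⊕ (Fin (d + 1) → ℝ) → Fin (d + 1) → ℝ := fun j => bary sQ (R' (lab j)) with hw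
      have hwsum : ∀ j, ∑ i, w j i = 1 := fun j => sum_bary hC _
      have hw0 : ∀ j, w j ≠ 0 := by
        intro j h
        have := hwsum j
        simp [h] at this
      -- Rescaling by positive factors moves the images to the unit sphere without changing
      -- determinant signs.
      set c : X ⊕ (Fin (d + 1) → ℝ) → ℝ := Sum.elim (fun _ => 1) fun v => ‖w (Sum.inr v)‖⁻¹ with hc
      have hcpos : ∀ j, 0 < c j := by
        rintro (x | v)
        · exact one_pos
        · exact inv_pos.mpr (norm_pos_iff.mpr (hw0 _))
      refine ⟨fun j => c j • w j, ?_, ?_⟩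
      · rintro (x | v) -
        · simp only [K, hc, Sum.elim_inl, one_smul, hw, Set.mem_singleton_iff]
          rw [hlab₁ _ x rfl, hR' x]
        · refine ⟨?_, ?_⟩
          · simp only [hc, Sum.elim_inr, mem_sphere_zero_iff_norm, norm_smul, norm_inv, norm_norm]
            exact inv_mul_cancel₀ (norm_ne_zero_iff.mpr (hw0 _))
          · change 0 ≤ ∑ i, c (Sum.inr v) * w (Sum.inr v) i
            rw [← Finset.mul_sum, hwsum, mul_one]
            exact (hcpos _).le
      · simp only [Set.mem_iInter]
        intro t ht
        change 0 ≤ (Matrix.of fun i => c (t.1 i) • w (t.1 i)).det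
        have h1 : 0 < (vertexMatrix sP).det * (homMatrix fun i => R (lab (t.1 i))).det := by
          refine hδu t ht _ fun i => ?_
          have hti : ∀ j, t.1 i = j → dist (R (lab j)) (pos j) < δ := by
            rintro (x | v) hj
            · rw [hlab₁ _ x rfl, hR.1 x]
              simpa [hpos] using hδ
            · refine hlab₂ _ v rfl ?_
              simp only [s, Finset.mem_biUnion, Finset.mem_univ, true_and]
              exact ⟨t, ht, i, by rw [hj]; simp⟩
          exact hti _ rfl
        have h2 : SignType.sign (homMatrix fun i => R' (lab (t.1 i))).det =
            SignType.sign (homMatrix fun i => R (lab (t.1 i))).det :=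
          congrFun hχ fun i => lab (t.1 i)
        have h3 : 0 < (vertexMatrix sQ).det * (homMatrix fun i => R' (lab (t.1 i))).det := by
          rw [← sign_eq_one_iff, sign_mul] at h1 hBC ⊢
          rw [h2]
          clear h2
          generalize SignType.sign (vertexMatrix sP).det = a at *
          generalize SignType.sign (vertexMatrix sQ).det = a' at *
          generalize SignType.sign (homMatrix fun i => R (lab (t.1 i))).det = a'' at *
          revert h1 hBC
          revert a a' a''
          decide
        rw [det_homMatrix_eq_bary hC] at h3
        have h4 : 0 < (Matrix.of fun i => w (t.1 i)).det := by
          rw [show (vertexMatrix sQ).det * ((Matrix.of fun i => bary sQ (R' (lab (t.1 i)))).det *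
            (vertexMatrix sQ).det) = (Matrix.of fun i => bary sQ (R' (lab (t.1 i)))).det *
              (vertexMatrix sQ).det ^ 2 by ring] at h3
          exact pos_of_mul_pos_left h3 (sq_nonneg _)
        have h5 := Matrix.det_mul_column (fun i => c (t.1 i)) (Matrix.of fun i => w (t.1 i))
        have h6 : 0 < ∏ i, c (t.1 i) := Finset.prod_pos fun i _ => hcpos _
        refine le_of_lt (lt_of_lt_of_eq (mul_pos h6 h4) ?_)
        rw [← h5]
        rfl
  obtain ⟨F, hFK, hFT⟩ := hne
  refine ⟨F, fun x => hFK (Sum.inl x) trivial, fun v => ?_, fun t ht htd => ?_⟩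
  · obtain ⟨h1, h2⟩ := hFK (Sum.inr v) trivial
    refine ⟨?_, h2⟩
    intro h0
    rw [h0] at h1
    simp at h1
  · exact Set.mem_iInter.mp hFT ⟨t, ht, htd⟩

end PointConfig

/-! ### Affine maps and the conclusion -/

namespace PointConfig

variable {d : ℕ}

theorem det_of_last_column {A : Matrix (Fin (d + 1)) (Fin (d + 1)) ℝ}
    (hA : ∀ i, A i (Fin.last d) = if i = Fin.last d then 1 else 0) :
    A.det = (A.submatrix Fin.castSucc Fin.castSucc).det := by
  rw [Matrix.det_succ_column A (Fin.last d), Finset.sum_eq_single (Fin.last d)]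
  · have h : (-1 : ℝ) ^ ((Fin.last d : ℕ) + (Fin.last d : ℕ)) = 1 := by
      rw [← two_mul, pow_mul]; simp
    rw [h, hA, if_pos rfl, one_mul, one_mul]
    simp only [Fin.succAbove_last]
  · intro i _ hi
    rw [hA, if_neg hi]; simp
  · simp

/-- The matrix of an affine map in homogeneous coordinates, acting on row vectors. -/
noncomputable def affineMatrix (φ : (Fin d → ℝ) ≃ᵃ[ℝ] (Fin d → ℝ)) :
    Matrix (Fin (d + 1)) (Fin (d + 1)) ℝ :=
  Matrix.of fun i => Fin.lastCases (motive := fun _ => Fin (d + 1) → ℝ) (homCoord (φ 0))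
    (fun i => Fin.snoc (φ.linear (Pi.single i 1)) 0) i

theorem vecMul_affineMatrix (φ : (Fin d → ℝ) ≃ᵃ[ℝ] (Fin d → ℝ)) (p : Fin d → ℝ) :
    Matrix.vecMul (homCoord p) (affineMatrix φ) = homCoord (φ p) := by
  have hφ : φ p = φ.linear p + φ 0 := by
    have := φ.map_vadd 0 p
    simpa using this
  have hlin : φ.linear p = ∑ i, p i • φ.linear (Pi.single i 1) := by
    conv_lhs => rw [pi_eq_sum_univ' p, map_sum]
    simp only [map_smul]
  funext j
  rw [Matrix.vecMul, dotProduct, Fin.sum_univ_castSucc]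
  refine Fin.lastCases ?_ (fun j => ?_) j
  · simp [affineMatrix, homCoord]
  · simp only [affineMatrix, Matrix.of_apply, Fin.lastCases_castSucc, Fin.lastCases_last,
      homCoord_castSucc, homCoord_last, Fin.snoc_castSucc, one_mul]
    rw [hφ, hlin]
    simp

theorem det_affineMatrix (φ : (Fin d → ℝ) ≃ᵃ[ℝ] (Fin d → ℝ)) :
    (affineMatrix φ).det = LinearMap.det (φ.linear : (Fin d → ℝ) →ₗ[ℝ] (Fin d → ℝ)) := by
  rw [det_of_last_column, ← LinearMap.det_toMatrix', ← Matrix.det_transpose]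
  · congr 1
    ext i j
    simp [affineMatrix, LinearMap.toMatrix'_apply]
  · intro i
    refine Fin.lastCases ?_ (fun i => ?_) i
    · simp [affineMatrix, homCoord_last]
    · simp [affineMatrix]

theorem det_homMatrix_affine (φ : (Fin d → ℝ) ≃ᵃ[ℝ] (Fin d → ℝ)) (p : Fin (d + 1) → Fin d → ℝ) :
    (homMatrix fun i => φ (p i)).det =
      (homMatrix p).det * LinearMap.det (φ.linear : (Fin d → ℝ) →ₗ[ℝ] (Fin d → ℝ)) := by
  rw [det_homMatrix, det_homMatrix, ← det_affineMatrix, ← det_of_vecMul]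
  simp only [vecMul_affineMatrix]

theorem chirotope_affine {φ : (Fin d → ℝ) ≃ᵃ[ℝ] (Fin d → ℝ)}
    (hφ : 0 < LinearMap.det (φ.linear : (Fin d → ℝ) →ₗ[ℝ] (Fin d → ℝ))) {Y : Type u}
    (R : PointConfig d Y) : chirotope (fun y => φ (R y)) = chirotope R := by
  funext t
  simp only [chirotope, orient]
  rw [det_homMatrix_affine, sign_mul, sign_pos hφ, mul_one]

theorem DirectlyAffinelyEquivalent.symm {X : Type u} {P Q : PointConfig d X}
    (h : P.DirectlyAffinelyEquivalent Q) : Q.DirectlyAffinelyEquivalent P := by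
  obtain ⟨φ, hφ, hPQ⟩ := h
  refine ⟨φ.symm, ?_, fun i => by rw [← hPQ, AffineEquiv.symm_apply_apply]⟩
  have h1 : LinearMap.det (φ.symm.linear : (Fin d → ℝ) →ₗ[ℝ] (Fin d → ℝ)) *
      LinearMap.det (φ.linear : (Fin d → ℝ) →ₗ[ℝ] (Fin d → ℝ)) = 1 :=
    LinearEquiv.det_symm_mul_det φ.linear
  exact pos_of_mul_pos_left (h1 ▸ one_pos) hφ.le

theorem DirectlyAffinelyEquivalent.realizableOnTop {X Y : Type u} {P Q : PointConfig d X}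
    (h : P.DirectlyAffinelyEquivalent Q) {ι : X ↪ Y} {χ : (Fin (d + 1) → Y) → SignType}
    (hχ : RealizableOnTop ι χ P) : RealizableOnTop ι χ Q := by
  obtain ⟨φ, hφ, hPQ⟩ := h
  obtain ⟨R, hR, hRχ⟩ := hχ
  exact ⟨fun y => φ (R y), fun i => (congrArg φ (hR i)).trans (hPQ i), by rw [chirotope_affine hφ, hRχ]⟩

/-- Configurations with the same barycentric coordinates with respect to equally oriented
simplices are directly affinely equivalent. -/
theorem directlyAffinelyEquivalent_of_bary_eq {X : Type u} {P Q : PointConfig d X}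
    {sP sQ : Fin (d + 1) → Fin d → ℝ} (hdet : 0 < (vertexMatrix sP).det * (vertexMatrix sQ).det)
    (h : ∀ x, bary sP (P x) = bary sQ (Q x)) : P.DirectlyAffinelyEquivalent Q := by
  have hB : (vertexMatrix sP).det ≠ 0 := left_ne_zero_of_mul hdet.ne'
  have hC : (vertexMatrix sQ).det ≠ 0 := right_ne_zero_of_mul hdet.ne'
  set A := (vertexMatrix sP)⁻¹ * vertexMatrix sQ with hA
  -- Both simplices turn the coordinate sum into the last homogeneous coordinate, so the change of
  -- simplex preserves that coordinate and is affine.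
  have hlast : ∀ i, A i (Fin.last d) = if i = Fin.last d then 1 else 0 := by
    intro i
    have h1 : A i (Fin.last d) =
        Matrix.vecMul (Matrix.vecMul (Pi.single i 1) (vertexMatrix sP)⁻¹) (vertexMatrix sQ)
          (Fin.last d) := by
      rw [Matrix.vecMul_vecMul, ← hA]; simp
    rw [h1, vecMul_vertexMatrix_last, ← vecMul_vertexMatrix_last (s := sP), Matrix.vecMul_vecMul,
      Matrix.nonsing_inv_mul _ hB.isUnit, Matrix.vecMul_one, Pi.single_apply]
    simp [eq_comm]
  have hAdet : 0 < A.det := by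
    have h1 : (vertexMatrix sP).det * A.det = (vertexMatrix sQ).det := by
      rw [← Matrix.det_mul, hA, ← Matrix.mul_assoc, Matrix.mul_nonsing_inv _ hB.isUnit,
        Matrix.one_mul]
    rw [← h1, ← mul_assoc] at hdet
    exact pos_of_mul_pos_right hdet (mul_self_nonneg _)
  set N := A.submatrix Fin.castSucc Fin.castSucc with hN
  have hNdet : LinearMap.det (Matrix.toLin' N.transpose) = A.det := by
    rw [LinearMap.det_toLin', Matrix.det_transpose, det_of_last_column hlast]
  let L := LinearMap.equivOfDetNeZero (Matrix.toLin' N.transpose) (hNdet ▸ hAdet.ne')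
  refine ⟨L.toAffineEquiv.trans
    (AffineEquiv.constVAdd ℝ (Fin d → ℝ) fun j => A (Fin.last d) j.castSucc), ?_, fun x => ?_⟩
  · have : (((L.toAffineEquiv.trans (AffineEquiv.constVAdd ℝ (Fin d → ℝ)
        fun j => A (Fin.last d) j.castSucc)).linear : (Fin d → ℝ) ≃ₗ[ℝ] (Fin d → ℝ)) :
        (Fin d → ℝ) →ₗ[ℝ] (Fin d → ℝ)) = Matrix.toLin' N.transpose := by
      ext v
      rfl
    rw [this, hNdet]
    exact hAdet
  · apply homCoord_injective
    have h1 : homCoord (Q x) = Matrix.vecMul (homCoord (P x)) A := by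
      rw [← vecMul_bary hC, ← h x, bary, Matrix.vecMul_vecMul]
    rw [h1]
    funext j
    refine Fin.lastCases ?_ (fun j => ?_) j
    · rw [homCoord_last, Matrix.vecMul, dotProduct, Fin.sum_univ_castSucc]
      simp [hlast, homCoord_last]
    · rw [homCoord_castSucc, Matrix.vecMul, dotProduct, Fin.sum_univ_castSucc]
      change A (Fin.last d) j.castSucc + (Matrix.toLin' N.transpose (P x)) j = _
      simp only [Matrix.toLin'_apply, Matrix.mulVec, dotProduct, homCoord_castSucc, homCoord_last,
        hN, Matrix.transpose_apply, Matrix.submatrix_apply, one_mul]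
      rw [add_comm]
      simp only [mul_comm]

/-- If all generic extensions of `P` are realizable on top of `Q`, the configurations are directly
affinely equivalent. -/
theorem directlyAffinelyEquivalent_of_genericExtends (hd : 2 ≤ d) {X : Type u} [Finite X]
    {P Q : PointConfig d X} (hP : P.FullDimensional)
    (H : ∀ (Y : Type u) [Finite Y] (ι : X ↪ Y) (R : PointConfig d Y),
      GenericExtends ι R P → RealizableOnTop ι R.chirotope Q) :
    P.DirectlyAffinelyEquivalent Q := by
  classical
  obtain ⟨b, hb⟩ := exists_simplex hP
  -- With no new labels, `P` is a generic extension of itself and `Q` is the only extension of `Q`.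
  have hχ : chirotope Q = chirotope P := by
    obtain ⟨R, hR, h⟩ := H X (Function.Embedding.refl X) P
      ⟨fun _ => rfl, fun y hy => absurd ⟨y, rfl⟩ hy⟩
    have : R = Q := funext hR
    rw [← this, h]
  have hB : (vertexMatrix fun i => P (b i)).det ≠ 0 := by rwa [det_homMatrix] at hb
  have hBC : 0 < (vertexMatrix fun i => P (b i)).det * (vertexMatrix fun i => Q (b i)).det := by
    have h1 : SignType.sign (homMatrix fun i => Q (b i)).det =
        SignType.sign (homMatrix fun i => P (b i)).det := congrFun hχ b
    rw [det_homMatrix, det_homMatrix] at h1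
    change SignType.sign (vertexMatrix fun i => Q (b i)).det =
      SignType.sign (vertexMatrix fun i => P (b i)).det at h1
    rw [← sign_eq_one_iff, sign_mul, h1, ← sign_mul, sign_eq_one_iff]
    exact mul_self_pos.mpr hB
  have hC : (vertexMatrix fun i => Q (b i)).det ≠ 0 := right_ne_zero_of_mul hBC.ne'
  obtain ⟨F, hFX, hFV, hFdet⟩ := exists_limit_realization hB hBC H
  set βP := fun x => bary (fun i => P (b i)) (P x) with hβP
  set βQ := fun x => bary (fun i => Q (b i)) (Q x) with hβQ
  have hsum_nonneg : ∀ j, 0 ≤ ∑ i, F j i := by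
    rintro (x | v)
    · rw [hFX, sum_bary hC]; exact zero_le_one
    · exact (hFV v).2
  have hne : ∀ j, F j ≠ 0 := by
    rintro (x | v) h
    · rw [hFX] at h
      have := sum_bary hC (Q x)
      simp [h] at this
    · exact (hFV v).1 h
  have hdet : ∀ sel : (Fin (d + 1) → ℝ) → X ⊕ (Fin (d + 1) → ℝ),
      (∀ z, Sum.elim βP id (sel z) = z) → ∀ M : Fin (d + 1) → Fin (d + 1) → ℝ,
      (∀ i, 0 < ∑ j, M i j) → 0 < (Matrix.of M).det →
      0 ≤ (Matrix.of fun i => F (sel (M i))).det := by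
    intro sel hsel M hM hMdet
    refine hFdet (fun i => sel (M i)) (fun i => ?_) ?_
    · have := hM i
      rwa [← hsel (M i)] at this
    · have : (fun i => Sum.elim βP id (sel (M i))) = M := funext fun i => hsel (M i)
      rw [← this] at hMdet
      exact hMdet
  -- A coordinate vector is both a vertex label and a free vector, and the limit may treat the two
  -- differently. Choosing the vertex label makes the simplex exactly fixed.
  let sel : (Fin (d + 1) → ℝ) → X ⊕ (Fin (d + 1) → ℝ) := fun z =>
    if h : ∃ i, z = Pi.single i 1 then Sum.inl (b h.choose) else Sum.inr z
  have hvert : ∀ i, βP (b i) = Pi.single i 1 := fun i => bary_vertex hB i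
  have hsel : ∀ z, Sum.elim βP id (sel z) = z := by
    intro z
    by_cases h : ∃ i, z = Pi.single i 1
    · simp only [sel, dif_pos h, Sum.elim_inl, hvert]
      exact h.choose_spec.symm
    · simp only [sel, dif_neg h, Sum.elim_inr, id]
  have hweak : IsWeakMap fun z => F (sel z) := by
    refine ⟨fun z _ => hne _, fun z _ => hsum_nonneg _, fun i => ?_, hdet sel hsel⟩
    have h : ∃ i', (Pi.single i 1 : Fin (d + 1) → ℝ) = Pi.single i' 1 := ⟨i, rfl⟩
    simp only [sel, dif_pos h, hFX]
    exact (bary_vertex hC _).trans h.choose_spec.symm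
  have hcard : 3 ≤ Fintype.card (Fin (d + 1)) := by simp; omega
  have hrigid : ∀ z : Fin (d + 1) → ℝ, 0 < ∑ i, z i → ∃ c : ℝ, 0 < c ∧ F (sel z) = c • z :=
    fun z hz => hweak.eq_smul hcard hz
  refine directlyAffinelyEquivalent_of_bary_eq hBC fun x => ?_
  change βP x = βQ x
  have hsumP : ∑ i, βP x i = 1 := sum_bary hB _
  -- The rigidity of `sel` concerns free vectors and vertices, not the label `x`. Reassigning the
  -- single vector `βP x` to this label keeps the map projectively the identity on an open set, so
  -- the extension lemma reaches the image of `x`.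
  let sel' : (Fin (d + 1) → ℝ) → X ⊕ (Fin (d + 1) → ℝ) := fun z =>
    if z = βP x then Sum.inl x else sel z
  have hsel' : ∀ z, Sum.elim βP id (sel' z) = z := by
    intro z
    by_cases h : z = βP x
    · simp [sel', h]
    · simp only [sel', if_neg h, hsel]
  obtain ⟨c, hc, h⟩ := eq_smul_of_eq_smul_on_open hcard (F := fun z => F (sel' z))
    (fun z _ => hne _) (hdet sel' hsel')
    (fun z hz c hcz => by
      have h1 := hsum_nonneg (sel' z)
      rw [show F (sel' z) = c • z from hcz] at h1
      simp only [Pi.smul_apply, smul_eq_mul, ← Finset.mul_sum] at h1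
      exact nonneg_of_mul_nonneg_left h1 hz)
    (U := {z | 0 < ∑ i, z i} ∩ {βP x}ᶜ)
    ((isOpen_lt continuous_const (by fun_prop)).inter isOpen_compl_singleton)
    ⟨(2 : ℝ) • βP x, by simp [← Finset.mul_sum, hsumP], fun h2 => by
      have h3 := congrArg (fun v => ∑ i, v i) (Set.mem_singleton_iff.mp h2)
      simp [← Finset.mul_sum, hsumP] at h3⟩
    (fun z hz => hz.1)
    (fun z hz => by
      have : sel' z = sel z := if_neg hz.2
      simp only [this]
      exact hrigid z hz.1)
    (z := βP x) (by rw [hsumP]; exact one_pos)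
  have h1 : βQ x = c • βP x := by
    rw [← h]
    simp only [sel', if_true, hFX, hβQ]
  -- Both barycentric vectors have sum one.
  have h2 : c = 1 := by
    have h3 := congrArg (fun v => ∑ i, v i) h1
    simp only [Pi.smul_apply, smul_eq_mul, ← Finset.mul_sum, hsumP, mul_one] at h3
    rw [← h3]
    exact sum_bary hC _
  rw [h1, h2, one_smul]

end PointConfig

theorem theorem1 (d : ℕ) (hd : 2 ≤ d) {X : Type u} [Finite X] (P Q : PointConfig d X)
    (hP : P.FullDimensional) (hQ : Q.FullDimensional) :
    (P.DirectlyAffinelyEquivalent Q ↔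
      ∀ (Y : Type u) [Finite Y] (ι : X ↪ Y) (R : PointConfig d Y),
        PointConfig.GenericExtends ι R P →
          PointConfig.RealizableOnTop ι R.chirotope Q) ∧
    (P.SameExtensions Q ↔ P.DirectlyAffinelyEquivalent Q) := by
  refine ⟨⟨fun h Y _ ι R hR => h.realizableOnTop ⟨R, hR.1, rfl⟩,
    fun H => PointConfig.directlyAffinelyEquivalent_of_genericExtends hd hP H⟩,
    fun h => PointConfig.directlyAffinelyEquivalent_of_genericExtends hd hP
      fun Y _ ι R hR => (h Y ι R.chirotope).mp ⟨R, hR.1, rfl⟩,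
    fun h Y _ ι χ => ⟨h.realizableOnTop, h.symm.realizableOnTop⟩⟩
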